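/- **Setting.** Qubits are labelled by natural numbers; for a finite set $V$ of labels let $\mathfrak H_V=\bigotimes_{i\in V}\mathbb C^2$. A *pattern* consists of a finite set $V$, subsets $I,O\subseteq V$ (inputs and outputs, possibly overlapping), and a finite sequence of commands on qubits of $V$, written from right to left in the order of execution. The commands are: $E_{ij}$ ($i\neq j$), which applies controlled-$Z$ to the qubits $i,j$; the corrections $X_i^{s}$, $Z_i^{s}$, which apply the Pauli operator iff $s=1$; and the destructive measurement $[M_i^{\alpha}]$, with signals $s,t$, of qubit $i$ in the basis $\tfrac1{\sqrt2}(|0\rangle+e^{i\alpha'}|1\rangle)$ (outcome $s_i=0$), $\tfrac1{\sqrt2}(|0\rangle-e^{i\alpha'}|1\rangle)$ (outcome $s_i=1$), where $\alpha'=(-1)^s\alpha+t\pi$. Signals are sums modulo $2$ of measurement outcomes. A pattern is *definite* if no command depends on an outcome not yet measured, no command acts on a qubit already measured, and a qubit is measured iff it is not an output. To run a pattern on $q\in\mathfrak H_I$, tensor $q$ with $|+\rangle$ at every non-input qubit and execute the commands; a measurement branches into its two outcomes, and the state is projected without renormalisation. A *branch* from $q$ to $q'\in\mathfrak H_O$ is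 such a run that ends in $q'\ne0$. The pattern is *deterministic* if any two outputs of branches from the same input differ only by a scalar. It *realises* (or *implements*) a linear map $U:\mathfrak H_I\to\mathfrak H_O$ if it is deterministic and, for every $q\neq0$, there is a branch from $q$, and for every branch from $q$ to $q'$ the vectors $Uq$ and $\frac{\|q\|}{\|q'\|}q'$ agree up to a phase. Patterns $\mathfrak P_1,\mathfrak P_2$ with $V_1\cap V_2=O_1=I_2$ have a *composite* $\mathfrak P_2\mathfrak P_1$ with $V=V_1\cup V_2$, $I=I_1$, $O=O_2$ and concatenated commands; if $V_1\cap V_2=\varnothing$ they have a *tensor* $\mathfrak P_2\otimes\mathfrak P_1$ with $V=V_1\cup V_2$, $I=I_1\cup I_2$, $O=O_1\cup O_2$ and concatenated commands. For distinct qubits $i,j$, let $\mathfrak J(\alpha)(i,j)$ be the pattern $X_j^{s_i}M_i^{-\alpha}E_{ij}$ with $V=\{i,j\}$, $I=\{i\}$, $O=\{j\}$, and let $\wedge\mathfrak Z(i,j)$ be the pattern $E_{ij}$ with $V=I=O=\{i,j\}$. Let $$J(\alpha)=\frac1{\sqrt2}\begin{pmatrix}1&e^{i\alpha}\\1&-e^{i\alpha}\end{pmatrix}.$$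 **Proposition (the patterns $\mathfrak J(\alpha)$ and $\wedge\mathfrak Z$ are universal).** 1. For every real $\alpha$ and all $i\ne j$, the pattern $\mathfrak J(\alpha)(i,j)$ is definite and realises $J(\alpha)$, as a map from the space of qubit $i$ to that of qubit $j$. 2. For all $i\neq j$, the pattern $\wedge\mathfrak Z(i,j)$ is definite and realises controlled-$Z$ on $\mathfrak H_{\{i,j\}}$. 3. For every non-empty finite set $V$ of qubits, the operators $J(\alpha)$, $\alpha\in[0,2\pi]$, applied at single qubits of $V$, and controlled-$Z$, applied to pairs of distinct qubits of $V$, generate under composition exactly the group of all unitary operators on $\mathfrak H_V$. 4. For all disjoint finite sets $I,O$ of qubits with $I\neq\varnothing$ and every unitary $U:\mathfrak H_I\to\mathfrak H_O$ (so for every unitary on $n\ge1$ qubits, with any labelling of the $n$ inputs and any labelling of the $n$ outputs by other names), there is a definite pattern with inputs $I$ and outputs $O$ that realises $U$ and is obtained by composition and tensor from patterns $\mathfrak J(\alpha)(i,j)$, $\alpha\in[0,2\pi]$, and $\wedge\mathfrak Z(i,j)$. -/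

import Mathlib

noncomputable section

namespace OneWay

/-! ### Qubits, states and operators -/

/-- The state space of the qubits with labels in `V`, that is `⨂_{i ∈ V} ℂ²`, in coordinates with
respect to the computational basis `|x⟩`, `x : V → {0,1}`. -/
abbrev Hil (V : Finset ℕ) : Type := EuclideanSpace ℂ (V → Fin 2)

/-- The bit that the basis label `x` gives to the qubit `i` (only used for `i ∈ V`). -/
def bit {V : Finset ℕ} (x : V → Fin 2) (i : ℕ) : Fin 2 :=
  if h : i ∈ V then x ⟨i, h⟩ else 0

/-- The basis label on `V` with bit `b` at `i` and the bits of `x` elsewhere. -/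
def setBit {W : Finset ℕ} (V : Finset ℕ) (x : W → Fin 2) (i : ℕ) (b : Fin 2) : V → Fin 2 :=
  fun k => if k.1 = i then b else bit x k.1

/-- The 1-qubit operator with matrix `A` applied at qubit `i`. -/
def localOp {V : Finset ℕ} (A : Matrix (Fin 2) (Fin 2) ℂ) (i : ℕ) : Hil V →ₗ[ℂ] Hil V where
  toFun q := WithLp.toLp 2 fun x => ∑ b : Fin 2, A (bit x i) b * q (setBit V x i b)
  map_add' p q := by
    ext x
    simp [mul_add, Finset.sum_add_distrib]
  map_smul' c q := by
    ext x
    simp only [PiLp.smul_apply, smul_eq_mul, RingHom.id_apply, Finset.mul_sum]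
    exact Finset.sum_congr rfl fun b _ => by ring

/-- The 1-qubit operator with matrix `A`, from the space of qubit `i` to that of qubit `j`. -/
def wireOp (A : Matrix (Fin 2) (Fin 2) ℂ) (i j : ℕ) : Hil {i} →ₗ[ℂ] Hil {j} where
  toFun q := WithLp.toLp 2 fun x => ∑ b : Fin 2, A (bit x j) b * q (fun _ => b)
  map_add' p q := by
    ext x
    simp [mul_add, Finset.sum_add_distrib]
  map_smul' c q := by
    ext x
    simp only [PiLp.smul_apply, smul_eq_mul, RingHom.id_apply, Finset.mul_sum]
    exact Finset.sum_congr rfl fun b _ => by ring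

/-- Controlled-`Z` on the qubits `i` and `j`. -/
def ctrlZ {V : Finset ℕ} (i j : ℕ) : Hil V →ₗ[ℂ] Hil V where
  toFun q := WithLp.toLp 2 fun x =>
    (if bit x i = 1 ∧ bit x j = 1 then (-1 : ℂ) else 1) * q x
  map_add' p q := by
    ext x
    simp [mul_add]
  map_smul' c q := by
    ext x
    simp only [PiLp.smul_apply, smul_eq_mul, RingHom.id_apply]
    ring

/-- The Pauli matrix `X`. -/
def pauliX : Matrix (Fin 2) (Fin 2) ℂ := !![0, 1; 1, 0]

/-- The Pauli matrix `Z`. -/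
def pauliZ : Matrix (Fin 2) (Fin 2) ℂ := !![1, 0; 0, -1]

/-- `J(α) = (1/√2) [[1, e^{iα}], [1, -e^{iα}]]`. -/
def matJ (α : ℝ) : Matrix (Fin 2) (Fin 2) ℂ :=
  ((1 / Real.sqrt 2 : ℝ) : ℂ) •
    !![1, Complex.exp (Complex.I * α); 1, -Complex.exp (Complex.I * α)]

/-- The measurement basis of angle `α`: `(|0⟩ + e^{iα}|1⟩)/√2` for the outcome `0`
and `(|0⟩ - e^{iα}|1⟩)/√2` for the outcome `1`. -/
def measKet (α : ℝ) (r : ZMod 2) : Fin 2 → ℂ :=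
  ((1 / Real.sqrt 2 : ℝ) : ℂ) •
    ![1, (if r = 0 then 1 else -1) * Complex.exp (Complex.I * α)]

/-- The linear form `⟨ψ|` applied at qubit `i`; `W` is the set of remaining qubits. -/
def braAt {V : Finset ℕ} (W : Finset ℕ) (ψ : Fin 2 → ℂ) (i : ℕ) : Hil V →ₗ[ℂ] Hil W where
  toFun q := WithLp.toLp 2 fun x => ∑ b : Fin 2, star (ψ b) * q (setBit V x i b)
  map_add' p q := by
    ext x
    simp [mul_add, Finset.sum_add_distrib]
  map_smul' c q := by
    ext x
    simp only [PiLp.smul_apply, smul_eq_mul, RingHom.id_apply, Finset.mul_sum]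
    exact Finset.sum_congr rfl fun b _ => by ring

/-- Preparation: an input state on `I` is tensored with `|+⟩` at every qubit of `V \ I`. -/
def prep {I V : Finset ℕ} (hI : I ⊆ V) : Hil I →ₗ[ℂ] Hil V where
  toFun q := WithLp.toLp 2 fun x =>
    ((1 / Real.sqrt 2 : ℝ) : ℂ) ^ (V \ I).card * q (fun k => x ⟨k.1, hI k.2⟩)
  map_add' p q := by
    ext x
    simp [mul_add]
  map_smul' c q := by
    ext x
    simp only [PiLp.smul_apply, smul_eq_mul, RingHom.id_apply]
    ring

/-! ### Commands and patterns -/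

/-- A signal `∑_{i ∈ s} s_i` is given by its domain. -/
abbrev Signal : Type := Finset ℕ

/-- The commands: entanglement `E_ij`, dependent measurement `[M_i^α]` with signals `s` (for the
`X`-action) and `t` (for the `Z`-action), and dependent corrections `X_i^s`, `Z_i^s`. -/
inductive Command : Type
  | E (i j : ℕ)
  | M (i : ℕ) (α : ℝ) (s t : Signal)
  | X (i : ℕ) (s : Signal)
  | Z (i : ℕ) (s : Signal)

/-- The qubits on which a command acts. -/
def Command.qubits : Command → Finset ℕ
  | .E i j => {i, j}
  | .M i _ _ _ => {i}
  | .X i _ => {i}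
  | .Z i _ => {i}

/-- The qubits on whose measurement outcomes a command depends. -/
def Command.dependsOn : Command → Finset ℕ
  | .E _ _ => ∅
  | .M _ _ s t => s ∪ t
  | .X _ s => s
  | .Z _ s => s

/-- The qubits that a command measures. -/
def Command.measures : Command → Finset ℕ
  | .M i _ _ _ => {i}
  | _ => ∅

/-- A command is a command on `V`: it acts on qubits of `V`, and an entanglement command acts on
two distinct qubits. -/
def Command.IsOn (V : Finset ℕ) (A : Command) : Prop :=
  A.qubits ⊆ V ∧ ∀ i j, A = .E i j → i ≠ j

/-- A pattern with inputs `I` and outputs `O`: a computation space `V` that contains both, and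
a sequence of commands on `V`, listed in the order of execution (`[A₁, …, Aₙ]` for
`Aₙ ⋯ A₁`). -/
structure Pattern (I O : Finset ℕ) : Type where
  V : Finset ℕ
  inputs_subset : I ⊆ V
  outputs_subset : O ⊆ V
  cmds : List Command
  isOn : ∀ A ∈ cmds, A.IsOn V

theorem Command.IsOn.mono {V W : Finset ℕ} {A : Command} (h : A.IsOn V) (hVW : V ⊆ W) :
    A.IsOn W :=
  ⟨h.1.trans hVW, h.2⟩

/-- The composite pattern `Q P`, for patterns with `V₁ ∩ V₂ = O₁ = I₂`. -/
def Pattern.comp {I K O : Finset ℕ} (Q : Pattern K O) (P : Pattern I K)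
    (_h : P.V ∩ Q.V = K) : Pattern I O where
  V := P.V ∪ Q.V
  inputs_subset := P.inputs_subset.trans Finset.subset_union_left
  outputs_subset := Q.outputs_subset.trans Finset.subset_union_right
  cmds := P.cmds ++ Q.cmds
  isOn A hA := (List.mem_append.1 hA).elim
    (fun h => (P.isOn A h).mono Finset.subset_union_left)
    (fun h => (Q.isOn A h).mono Finset.subset_union_right)

/-- The tensor pattern `Q ⊗ P`, for patterns with disjoint computation spaces. -/
def Pattern.tensor {I₁ O₁ I₂ O₂ : Finset ℕ} (Q : Pattern I₂ O₂) (P : Pattern I₁ O₁)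
    (_h : P.V ∩ Q.V = ∅) : Pattern (I₁ ∪ I₂) (O₁ ∪ O₂) where
  V := P.V ∪ Q.V
  inputs_subset := Finset.union_subset_union P.inputs_subset Q.inputs_subset
  outputs_subset := Finset.union_subset_union P.outputs_subset Q.outputs_subset
  cmds := P.cmds ++ Q.cmds
  isOn A hA := (List.mem_append.1 hA).elim
    (fun h => (P.isOn A h).mono Finset.subset_union_left)
    (fun h => (Q.isOn A h).mono Finset.subset_union_right)

/-- The set of qubits measured in a sequence of commands. -/
def measured (L : List Command) : Set ℕ := {i | ∃ A ∈ L, i ∈ A.measures}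

/-- The definiteness conditions: no command depends on an outcome not yet measured, no command
acts on a qubit already measured, and a qubit is measured iff it is not an output. -/
def Pattern.Definite {I O : Finset ℕ} (P : Pattern I O) : Prop :=
  (∀ L₁ A L₂, P.cmds = L₁ ++ A :: L₂ → ∀ i ∈ A.dependsOn, i ∈ measured L₁) ∧
  (∀ L₁ A L₂, P.cmds = L₁ ++ A :: L₂ → ∀ i ∈ A.qubits, i ∉ measured L₁) ∧
  (∀ i ∈ P.V, i ∈ measured P.cmds ↔ i ∉ O)

/-! ### Running a pattern -/

/-- An outcome map: a partial function from qubits to outcomes. -/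
abbrev OutcomeMap : Type := ℕ → Option (ZMod 2)

/-- The outcome map contains the domain of the signal. -/
def Known (Γ : OutcomeMap) (s : Signal) : Prop := ∀ i ∈ s, (Γ i).isSome

/-- The value `s_Γ ∈ ℤ/2` of a signal (used only if `Known Γ s`). -/
def signalValue (Γ : OutcomeMap) (s : Signal) : ZMod 2 := ∑ i ∈ s, (Γ i).getD 0

/-- The angle `(-1)^s α + t π` of a dependent measurement. -/
def depAngle (α : ℝ) (s t : ZMod 2) : ℝ := (-1) ^ s.val * α + t.val * Real.pi

/-- A computation state: a quantum state on some set of qubits and an outcome map. -/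
structure CompState : Type where
  V : Finset ℕ
  q : Hil V
  Γ : OutcomeMap

/-- The action of the commands on computation states; quantum states are not renormalised. -/
inductive Step : Command → CompState → CompState → Prop
  | entangle {V : Finset ℕ} {q : Hil V} {Γ : OutcomeMap} {i j : ℕ}
      (hi : i ∈ V) (hj : j ∈ V) (hij : i ≠ j) :
      Step (.E i j) ⟨V, q, Γ⟩ ⟨V, ctrlZ i j q, Γ⟩
  | correctX {V : Finset ℕ} {q : Hil V} {Γ : OutcomeMap} {i : ℕ} {s : Signal}
      (hi : i ∈ V) (hs : Known Γ s) :
      Step (.X i s) ⟨V, q, Γ⟩ ⟨V, localOp (pauliX ^ (signalValue Γ s).val) i q, Γ⟩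
  | correctZ {V : Finset ℕ} {q : Hil V} {Γ : OutcomeMap} {i : ℕ} {s : Signal}
      (hi : i ∈ V) (hs : Known Γ s) :
      Step (.Z i s) ⟨V, q, Γ⟩ ⟨V, localOp (pauliZ ^ (signalValue Γ s).val) i q, Γ⟩
  | measure {V W : Finset ℕ} {q : Hil V} {Γ : OutcomeMap} {i : ℕ} {α : ℝ} {s t : Signal}
      (hi : i ∈ V) (hW : W = V.erase i) (hs : Known Γ s) (ht : Known Γ t) (r : ZMod 2) :
      Step (.M i α s t) ⟨V, q, Γ⟩
        ⟨W, braAt W (measKet (depAngle α (signalValue Γ s) (signalValue Γ t)) r) i q,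
          Function.update Γ i (some r)⟩

/-- Running a sequence of commands in the order of the list. -/
def Run : List Command → CompState → CompState → Prop
  | [], σ, τ => σ = τ
  | A :: L, σ, τ => ∃ ρ, Step A σ ρ ∧ Run L ρ τ

/-- There is a branch of the pattern from the input `q` to the (non-zero) output `q'`. -/
def Pattern.Branch {I O : Finset ℕ} (P : Pattern I O) (q : Hil I) (q' : Hil O) : Prop :=
  q' ≠ 0 ∧ ∃ Γ, Run P.cmds ⟨P.V, prep P.inputs_subset q, fun _ => none⟩ ⟨O, q', Γ⟩

/-- Any two outputs for the same input differ only by a scalar. -/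
def Pattern.Deterministic {I O : Finset ℕ} (P : Pattern I O) : Prop :=
  ∀ q q' q'', P.Branch q q' → P.Branch q q'' → ∃ c : ℂ, q'' = c • q'

/-- The pattern realises (implements) `U`: it is deterministic, and for every non-zero input `q`
there are branches, and `U q` is, up to a phase, the renormalised output `(‖q‖ / ‖q'‖) q'` of
each of them. -/
def Pattern.Realises {I O : Finset ℕ} (P : Pattern I O) (U : Hil I →ₗ[ℂ] Hil O) : Prop :=
  P.Deterministic ∧ ∀ q, q ≠ 0 → (∃ q', P.Branch q q') ∧
    ∀ q', P.Branch q q' → ∃ c : ℂ, ‖c‖ = 1 ∧ U q = c • ((‖q‖ / ‖q'‖ : ℝ) : ℂ) • q'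

/-! ### The two generating patterns -/

/-- The pattern `𝔍(α) = X_j^{s_i} M_i^{-α} E_ij` with input `i` and output `j`. -/
def patternJ (α : ℝ) (i j : ℕ) (h : i ≠ j) : Pattern {i} {j} where
  V := {i, j}
  inputs_subset := by simp
  outputs_subset := by simp
  cmds := [.E i j, .M i (-α) ∅ ∅, .X j {i}]
  isOn A hA := by
    simp only [List.mem_cons, List.not_mem_nil, or_false] at hA
    rcases hA with rfl | rfl | rfl
    · refine ⟨by simp [Command.qubits], fun a b hab => ?_⟩
      cases hab
      exact h
    · exact ⟨by simp [Command.qubits], fun a b hab => by cases hab⟩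
    · exact ⟨by simp [Command.qubits], fun a b hab => by cases hab⟩

/-- The pattern `E_ij`, in which `i` and `j` are both inputs and outputs. -/
def patternCZ (i j : ℕ) (h : i ≠ j) : Pattern {i, j} {i, j} where
  V := {i, j}
  inputs_subset := subset_rfl
  outputs_subset := subset_rfl
  cmds := [.E i j]
  isOn A hA := by
    simp only [List.mem_cons, List.not_mem_nil, or_false] at hA
    subst hA
    refine ⟨by simp [Command.qubits], fun a b hab => ?_⟩
    cases hab
    exact h

/-- The patterns obtained by composition and tensor from copies (on any qubits) of `𝔍(α)`,
`α ∈ [0, 2π]`, and of `E_ij`. -/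
inductive Generated : ∀ {I O : Finset ℕ}, Pattern I O → Prop
  | ofJ (α : ℝ) (hα : α ∈ Set.Icc 0 (2 * Real.pi)) (i j : ℕ) (h : i ≠ j) :
      Generated (patternJ α i j h)
  | ofCZ (i j : ℕ) (h : i ≠ j) : Generated (patternCZ i j h)
  | comp {I K O : Finset ℕ} {Q : Pattern K O} {P : Pattern I K} (h : P.V ∩ Q.V = K) :
      Generated Q → Generated P → Generated (Q.comp P h)
  | tensor {I₁ O₁ I₂ O₂ : Finset ℕ} {Q : Pattern I₂ O₂} {P : Pattern I₁ O₁}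
      (h : P.V ∩ Q.V = ∅) : Generated Q → Generated P → Generated (Q.tensor P h)

/-- The operators `J(α)`, `α ∈ [0, 2π]`, at a single qubit of `V`, and controlled-`Z` at a pair of
distinct qubits of `V`. -/
def gates (V : Finset ℕ) : Set (Module.End ℂ (Hil V)) :=
  {G | (∃ α ∈ Set.Icc (0 : ℝ) (2 * Real.pi), ∃ i ∈ V, G = localOp (matJ α) i) ∨
    ∃ i ∈ V, ∃ j ∈ V, i ≠ j ∧ G = ctrlZ i j}

end OneWay

end

/-! Gates. Put H = J(0) and P(z) = diag(1, z). Then J(α) = H P(e^{iα}) and H² = 1, so the gates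
yield H and all phase gates; adjoints of gates are again products of gates, so the generated monoid
is a group. Conjugating controlled-Z by H gives controlled-X, and conjugating a diagonal operator by
controlled-X substitutes x_t + x_c for x_t in its phase function. The identity 2ab = a + b - (a ⊕ b)
then produces every phase c·∏ x_i, and sums of these give all real phase functions: every diagonal
unitary is generated (`diagOp_mem`). Diagonal operators and H clear the bits of a state one by one,
so the group is transitive on vectors of a given norm (`exists_map_eq_single`). Hence it contains
all complex reflections, and these undo an arbitrary unitary one basis vector at a time, as in
Householder's method (`closure_gates_eq_unitary`).

Patterns. States are treated as functions of the bits of all qubits, so that operators between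
varying sets of qubits become endomorphisms of one space. A qubit in |+⟩ is, up to normalisation, a
bit on which the function does not depend, and renaming qubits is precomposition.
`Pattern.Implements` asks for one exact operator, the same for all outcomes and in the presence of
other qubits; locality of the operators makes it stable under composition and tensor. The two
generators satisfy it by computation (`patternJ_implements`, `patternCZ_implements`). Since J(0)² =
1, two copies of 𝔍(0) form a wire, and a gate with wires in parallel carries a whole register to a
new one. Induction on words of gates, with a fresh register at each step, implements every unitary
(`implementable_lift`). -/

noncomputable section

namespace OneWay

open Complex Finset

/-! ### Operators on a fixed set of qubits -/

section Operators

variable {V : Finset ℕ}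

theorem bit_coe (x : V → Fin 2) (i : V) : bit x i = x i := by
  simp [bit]

theorem setBit_coe (x : V → Fin 2) (i : V) (b : Fin 2) :
    setBit V x i b = Function.update x i b := by
  funext k
  by_cases h : k = i
  · subst h
    simp [setBit]
  · have h' : k.1 ≠ i.1 := fun e => h (Subtype.ext e)
    simp [setBit, h, h', bit_coe]

theorem localOp_apply (A : Matrix (Fin 2) (Fin 2) ℂ) (i : V) (q : Hil V) (x : V → Fin 2) :
    localOp A i q x = ∑ b : Fin 2, A (x i) b * q (Function.update x i b) := by
  simp only [localOp, LinearMap.coe_mk, AddHom.coe_mk, bit_coe, setBit_coe]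

theorem ctrlZ_apply (i j : V) (q : Hil V) (x : V → Fin 2) :
    ctrlZ i j q x = (if x i = 1 ∧ x j = 1 then (-1 : ℂ) else 1) * q x := by
  simp only [ctrlZ, LinearMap.coe_mk, AddHom.coe_mk, bit_coe]

theorem localOp_one (i : V) : localOp 1 (i : ℕ) = (1 : Module.End ℂ (Hil V)) := by
  ext q x
  simp [localOp_apply, Matrix.one_apply, Function.update_eq_self]

theorem localOp_mul (A B : Matrix (Fin 2) (Fin 2) ℂ) (i : V) :
    localOp (A * B) (i : ℕ) = (localOp A i * localOp B i : Module.End ℂ (Hil V)) := by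
  ext q x
  simp only [Module.End.mul_apply, localOp_apply, Matrix.mul_apply, Fin.sum_univ_two,
    Function.update_self, Function.update_idem]
  ring

/-- Writing `b` at the `i`-th bit and reading off the old value. -/
def swapBit (i : V) : Equiv.Perm ((V → Fin 2) × Fin 2) :=
  Function.Involutive.toPerm (fun p => (Function.update p.1 i p.2, p.1 i)) fun p => by
    simp

theorem star_localOp (A : Matrix (Fin 2) (Fin 2) ℂ) (i : V) :
    star (localOp A (i : ℕ) : Module.End ℂ (Hil V)) = localOp A.conjTranspose i := by
  rw [LinearMap.star_eq_adjoint, eq_comm, LinearMap.eq_adjoint_iff]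
  intro p q
  simp only [PiLp.inner_apply, localOp_apply, RCLike.inner_apply, map_sum, mul_sum, sum_mul]
  -- Both sides are sums over pairs (label, new bit); exchanging the new bit with the old one
  -- matches their terms.
  rw [← Fintype.sum_prod_type', ← Fintype.sum_prod_type', ← Equiv.sum_comp (swapBit i)]
  refine Finset.sum_congr rfl fun y _ => ?_
  simp [swapBit, Function.Involutive.toPerm, Matrix.conjTranspose_apply]
  ring

/-- The operator that is diagonal in the computational basis. -/
def diagOp (d : (V → Fin 2) → ℂ) : Module.End ℂ (Hil V) where
  toFun q := WithLp.toLp 2 fun x => d x * q x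
  map_add' p q := by
    ext x
    simp [mul_add]
  map_smul' c q := by
    ext x
    simp only [PiLp.smul_apply, smul_eq_mul, RingHom.id_apply]
    ring

theorem diagOp_apply (d : (V → Fin 2) → ℂ) (q : Hil V) (x : V → Fin 2) :
    diagOp d q x = d x * q x := rfl

theorem diagOp_mul (d e : (V → Fin 2) → ℂ) : diagOp (fun x => d x * e x) = diagOp d * diagOp e := by
  ext q x
  simp [diagOp_apply, mul_assoc]

theorem ctrlZ_eq_diagOp (i j : V) :
    (ctrlZ i j : Module.End ℂ (Hil V)) =
      diagOp fun x => if x i = 1 ∧ x j = 1 then -1 else 1 := by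
  ext q x
  simp only [ctrlZ_apply, diagOp_apply]

theorem star_diagOp (d : (V → Fin 2) → ℂ) : star (diagOp d) = diagOp fun x => star (d x) := by
  rw [LinearMap.star_eq_adjoint, eq_comm, LinearMap.eq_adjoint_iff]
  intro p q
  simp only [PiLp.inner_apply, diagOp_apply, RCLike.inner_apply, map_mul]
  refine Finset.sum_congr rfl fun y _ => ?_
  simp
  ring

/-- The phase gate `diag(1, z)`. -/
def matP (z : ℂ) : Matrix (Fin 2) (Fin 2) ℂ := !![1, 0; 0, z]

theorem sqrt_two_inv_mul_self :
    ((1 / Real.sqrt 2 : ℝ) : ℂ) * ((1 / Real.sqrt 2 : ℝ) : ℂ) = 1 / 2 := by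
  rw [← Complex.ofReal_mul, div_mul_div_comm, Real.mul_self_sqrt zero_le_two]
  norm_num

/-- This factorisation reduces all questions about `matJ α` to the involution `matJ 0` and phase
gates. -/
theorem matJ_eq (α : ℝ) : matJ α = matJ 0 * matP (Complex.exp (Complex.I * α)) := by
  ext a b
  fin_cases a <;> fin_cases b <;> simp [matJ, matP, Matrix.mul_apply, Fin.sum_univ_two]

theorem matJ_zero_mul_self : matJ 0 * matJ 0 = 1 := by
  have h := sqrt_two_inv_mul_self
  ext a b
  fin_cases a <;> fin_cases b <;>
    simp only [matJ, Matrix.mul_apply, Fin.sum_univ_two] <;> simp at h ⊢ <;> linear_combination 2 * h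

theorem conjTranspose_matJ_zero : (matJ 0).conjTranspose = matJ 0 := by
  ext a b
  fin_cases a <;> fin_cases b <;> simp [matJ, Matrix.conjTranspose_apply]

theorem conjTranspose_matP (z : ℂ) : (matP z).conjTranspose = matP (star z) := by
  ext a b
  fin_cases a <;> fin_cases b <;> simp [matP, Matrix.conjTranspose_apply]

theorem matP_mul (z w : ℂ) : matP (z * w) = matP z * matP w := by
  ext a b
  fin_cases a <;> fin_cases b <;> simp [matP, Matrix.mul_apply, Fin.sum_univ_two]

theorem matP_one : matP 1 = 1 := by
  ext a b
  fin_cases a <;> fin_cases b <;> simp [matP]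

theorem star_mul_self_of_norm {z : ℂ} (hz : ‖z‖ = 1) : star z * z = 1 := by
  have h := Complex.conj_mul' z
  rw [hz] at h
  simpa using h

theorem norm_exp_I_mul (α : ℝ) : ‖Complex.exp (Complex.I * α)‖ = 1 := by
  rw [mul_comm]
  exact Complex.norm_exp_ofReal_mul_I α

theorem exists_angle {z : ℂ} (hz : ‖z‖ = 1) :
    ∃ α ∈ Set.Icc (0 : ℝ) (2 * Real.pi), Complex.exp (Complex.I * α) = z := by
  have h : Complex.exp (Complex.I * z.arg) = z := by
    have := Complex.norm_mul_exp_arg_mul_I z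
    rw [hz] at this
    rw [mul_comm]
    simpa using this
  rcases le_or_gt 0 z.arg with h0 | h0
  -- The argument lies in (-π, π]; a negative one is moved into the allowed interval by adding 2π.
  · exact ⟨z.arg, ⟨h0, by linarith [Complex.arg_le_pi z, Real.pi_pos]⟩, h⟩
  · refine ⟨z.arg + 2 * Real.pi, ⟨by linarith [Complex.neg_pi_lt_arg z, Real.pi_pos],
      by linarith⟩, ?_⟩
    push_cast
    rw [mul_add, Complex.exp_add, h, mul_comm Complex.I, Complex.exp_two_pi_mul_I, mul_one]

theorem conjTranspose_matJ_mul_self (α : ℝ) : (matJ α).conjTranspose * matJ α = 1 := by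
  rw [matJ_eq, Matrix.conjTranspose_mul, conjTranspose_matJ_zero, conjTranspose_matP, mul_assoc,
    ← mul_assoc (matJ 0), matJ_zero_mul_self, one_mul, ← matP_mul,
    star_mul_self_of_norm (norm_exp_I_mul α), matP_one]

theorem gates_subset_unitary (V : Finset ℕ) :
    gates V ⊆ (unitary (Module.End ℂ (Hil V)) : Set (Module.End ℂ (Hil V))) := by
  rintro G (⟨α, -, i, hi, rfl⟩ | ⟨i, hi, j, hj, -, rfl⟩)
  · have h : star (localOp (matJ α) i : Module.End ℂ (Hil V)) * localOp (matJ α) i = 1 := by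
      rw [star_localOp _ ⟨i, hi⟩, ← localOp_mul _ _ ⟨i, hi⟩, conjTranspose_matJ_mul_self]
      exact localOp_one ⟨i, hi⟩
    -- In finite dimension a left inverse is also a right inverse.
    exact Unitary.mem_iff.2 ⟨h, mul_eq_one_comm.1 h⟩
  · have h : star (ctrlZ i j : Module.End ℂ (Hil V)) * ctrlZ i j = 1 := by
      rw [ctrlZ_eq_diagOp ⟨i, hi⟩ ⟨j, hj⟩, star_diagOp, ← diagOp_mul]
      ext q x
      simp only [diagOp_apply, Module.End.one_apply]
      split_ifs <;> simp
    exact Unitary.mem_iff.2 ⟨h, mul_eq_one_comm.1 h⟩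

theorem closure_gates_le_unitary (V : Finset ℕ) :
    Submonoid.closure (gates V) ≤ unitary (Module.End ℂ (Hil V)) :=
  Submonoid.closure_le.2 (gates_subset_unitary V)

end Operators

/-! ### Diagonal operators are generated -/

section Diagonal

variable {V : Finset ℕ}

theorem localOp_matJ_zero_mem (i : V) :
    (localOp (matJ 0) i : Module.End ℂ (Hil V)) ∈ Submonoid.closure (gates V) :=
  Submonoid.subset_closure
    (Or.inl ⟨0, ⟨le_rfl, by positivity⟩, i, i.2, rfl⟩)

theorem ctrlZ_mem {i j : V} (h : i ≠ j) :
    (ctrlZ i j : Module.End ℂ (Hil V)) ∈ Submonoid.closure (gates V) :=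
  Submonoid.subset_closure
    (Or.inr ⟨i, i.2, j, j.2, fun e => h (Subtype.ext e), rfl⟩)

theorem localOp_matP_mem (i : V) {z : ℂ} (hz : ‖z‖ = 1) :
    (localOp (matP z) i : Module.End ℂ (Hil V)) ∈ Submonoid.closure (gates V) := by
  obtain ⟨α, hα, rfl⟩ := exists_angle hz
  have h : matP (Complex.exp (Complex.I * α)) = matJ 0 * matJ α := by
    rw [matJ_eq α, ← mul_assoc, matJ_zero_mul_self, one_mul]
  rw [h, localOp_mul]
  exact mul_mem (localOp_matJ_zero_mem i)
    (Submonoid.subset_closure (Or.inl ⟨α, hα, i, i.2, rfl⟩))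

/-- The closure is only taken as a monoid; this supplies the inverses. The adjoint of J(α) is
P(e^{-iα}) J(0), and controlled-Z is self-adjoint. -/
theorem star_mem_closure_gates {g : Module.End ℂ (Hil V)} (hg : g ∈ Submonoid.closure (gates V)) :
    star g ∈ Submonoid.closure (gates V) := by
  induction hg using Submonoid.closure_induction with
  | mem g hg =>
    rcases hg with ⟨α, -, i, hi, rfl⟩ | ⟨i, hi, j, hj, hij, rfl⟩
    · rw [star_localOp _ ⟨i, hi⟩, matJ_eq, Matrix.conjTranspose_mul, conjTranspose_matJ_zero,
        conjTranspose_matP, localOp_mul _ _ ⟨i, hi⟩]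
      exact mul_mem (localOp_matP_mem ⟨i, hi⟩ (by rw [norm_star, norm_exp_I_mul]))
        (localOp_matJ_zero_mem ⟨i, hi⟩)
    · have h : star (ctrlZ i j : Module.End ℂ (Hil V)) = ctrlZ i j := by
        rw [ctrlZ_eq_diagOp ⟨i, hi⟩ ⟨j, hj⟩, star_diagOp]
        congr 1
        funext x
        split_ifs <;> simp
      rw [h]
      exact Submonoid.subset_closure (Or.inr ⟨i, hi, j, hj, hij, rfl⟩)
  | one =>
    rw [star_one]
    exact one_mem _
  | mul a b _ _ ha hb =>
    rw [star_mul]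
    exact mul_mem hb ha

/-- The diagonal operator with phases `exp (i θ x)`. -/
def phaseOp (θ : (V → Fin 2) → ℝ) : Module.End ℂ (Hil V) :=
  diagOp fun x => Complex.exp (Complex.I * θ x)

theorem phaseOp_add (θ η : (V → Fin 2) → ℝ) : phaseOp (θ + η) = phaseOp θ * phaseOp η := by
  rw [phaseOp, phaseOp, phaseOp, ← diagOp_mul]
  congr 1
  funext x
  rw [← Complex.exp_add, Pi.add_apply]
  push_cast
  ring_nf

/-- The phase functions of the diagonal operators that are generated by the gates. -/
def phaseSubmonoid (V : Finset ℕ) : AddSubmonoid ((V → Fin 2) → ℝ) where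
  carrier := {θ | phaseOp θ ∈ Submonoid.closure (gates V)}
  zero_mem' := by
    have h : phaseOp (0 : (V → Fin 2) → ℝ) = 1 := by
      ext q x
      simp [phaseOp, diagOp_apply]
    simp only [Set.mem_ofPred_eq, h]
    exact one_mem _
  add_mem' {a b} ha hb := by
    simp only [Set.mem_ofPred_eq] at ha hb ⊢
    rw [phaseOp_add]
    exact mul_mem ha hb

theorem mem_phaseSubmonoid {θ : (V → Fin 2) → ℝ} :
    θ ∈ phaseSubmonoid V ↔ phaseOp θ ∈ Submonoid.closure (gates V) := Iff.rfl

/-- The permutation of labels of a controlled-`X` with target `t` and control `c`. -/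
def cnotLabel (t c : V) (x : V → Fin 2) : V → Fin 2 := Function.update x t (x t + x c)

theorem cnotLabel_cnotLabel {t c : V} (h : t ≠ c) (x : V → Fin 2) :
    cnotLabel t c (cnotLabel t c x) = x := by
  have h2 : ∀ a b : Fin 2, a + b + b = a := by decide
  simp [cnotLabel, h.symm, h2]

/-- Controlled-`X`. -/
def cnot (t c : V) : Module.End ℂ (Hil V) :=
  localOp (matJ 0) t * ctrlZ t c * localOp (matJ 0) t

/-- On the target qubit, H Z H = X and H H = 1, according to the control bit. -/
theorem cnot_apply {t c : V} (h : t ≠ c) (q : Hil V) (x : V → Fin 2) :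
    cnot t c q x = q (cnotLabel t c x) := by
  have h2 := sqrt_two_inv_mul_self
  have hx : q x = q (Function.update x t (x t)) := by simp
  have h01 : ∀ a : Fin 2, a = 0 ∨ a = 1 := by decide
  simp only [cnot, Module.End.mul_apply, localOp_apply, ctrlZ_apply, Fin.sum_univ_two,
    Function.update_self, Function.update_idem, Function.update_of_ne h.symm, cnotLabel]
  rcases h01 (x t) with ht | ht <;> rcases h01 (x c) with hc | hc <;> rw [ht, hc] <;>
    simp [matJ] at h2 ⊢
  · linear_combination (2 * q (Function.update x t 0)) * h2
  · linear_combination (2 * q (Function.update x t 1)) * h2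
  · linear_combination (2 * q (Function.update x t 1)) * h2
  · linear_combination (2 * q (Function.update x t 0)) * h2

theorem cnot_mem {t c : V} (h : t ≠ c) : cnot t c ∈ Submonoid.closure (gates V) :=
  mul_mem (mul_mem (localOp_matJ_zero_mem t) (ctrlZ_mem h)) (localOp_matJ_zero_mem t)

/-- Controlled-X permutes the basis and is its own inverse, so conjugation by it permutes the
entries of a diagonal operator. -/
theorem comp_cnotLabel_mem {θ : (V → Fin 2) → ℝ} (hθ : θ ∈ phaseSubmonoid V) {t c : V}
    (h : t ≠ c) : (fun x => θ (cnotLabel t c x)) ∈ phaseSubmonoid V := by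
  have e : phaseOp (fun x => θ (cnotLabel t c x)) = cnot t c * phaseOp θ * cnot t c := by
    ext q x
    simp only [Module.End.mul_apply, cnot_apply h, phaseOp, diagOp_apply, cnotLabel_cnotLabel h]
  rw [mem_phaseSubmonoid, e]
  exact mul_mem (mul_mem (cnot_mem h) hθ) (cnot_mem h)

/-- The product of the bits in `A` and of the negated bits in `B`, times `c`. -/
def bitProd (A B : Finset V) (c : ℝ) (x : V → Fin 2) : ℝ :=
  if (∀ i ∈ A, x i = 1) ∧ ∀ i ∈ B, x i = 0 then c else 0

theorem bitProd_singleton_mem (i : V) (c : ℝ) : bitProd {i} ∅ c ∈ phaseSubmonoid V := by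
  have e : phaseOp (bitProd {i} ∅ c) = localOp (matP (Complex.exp (Complex.I * c))) (i : ℕ) := by
    ext q x
    have hx : q x = q (Function.update x i (x i)) := by simp
    have h01 : ∀ a : Fin 2, a = 0 ∨ a = 1 := by decide
    simp only [phaseOp, diagOp_apply, localOp_apply, bitProd, Fin.sum_univ_two]
    rw [hx]
    rcases h01 (x i) with h | h <;> simp [h, matP]
  rw [mem_phaseSubmonoid, e]
  exact localOp_matP_mem i (norm_exp_I_mul c)

/-- A global phase is a product of phase gates and Pauli `X` gates at one qubit. -/
theorem bitProd_empty_mem (hV : V.Nonempty) (c : ℝ) : bitProd (∅ : Finset V) ∅ c ∈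
    phaseSubmonoid V := by
  obtain ⟨i⟩ := hV.coe_sort
  have e : phaseOp (bitProd (∅ : Finset V) ∅ c) =
      localOp (matP (Complex.exp (Complex.I * c)) * (matJ 0 * matP (-1) * matJ 0 *
        matP (Complex.exp (Complex.I * c)) * (matJ 0 * matP (-1) * matJ 0))) (i : ℕ) := by
    -- P(z) X P(z) X is the scalar z: one phase gate acts on |1⟩, its conjugate by X on |0⟩.
    have hX : matJ 0 * matP (-1) * matJ 0 = pauliX := by
      have h := sqrt_two_inv_mul_self
      ext a b
      fin_cases a <;> fin_cases b <;>
        simp only [matJ, matP, pauliX, Matrix.mul_apply, Fin.sum_univ_two] <;> simp at h ⊢ <;>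
        linear_combination 2 * h
    ext q x
    have hx : q x = q (Function.update x i (x i)) := by simp
    have h01 : ∀ a : Fin 2, a = 0 ∨ a = 1 := by decide
    rw [hX]
    simp only [phaseOp, diagOp_apply, localOp_apply, bitProd, Fin.sum_univ_two]
    rw [hx]
    rcases h01 (x i) with h | h <;>
      simp [h, matP, pauliX, Matrix.mul_apply, Fin.sum_univ_two]
  have hP := localOp_matP_mem i (norm_exp_I_mul c)
  have hZ := localOp_matP_mem i (z := -1) (by simp)
  have hH := localOp_matJ_zero_mem i
  rw [mem_phaseSubmonoid, e]
  simp only [localOp_mul]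
  exact mul_mem hP (mul_mem (mul_mem (mul_mem (mul_mem hH hZ) hH) hP)
    (mul_mem (mul_mem hH hZ) hH))

/-- Multiply 2ab = a + b - (a ⊕ b) by the product over the remaining bits `S`. Each term on the
right has one factor fewer, and a ⊕ b is what controlled-X writes into bit a. The coefficient is
halved, so the induction needs all real `c` at once. -/
theorem bitProd_left_mem (hV : V.Nonempty) (n : ℕ) :
    ∀ (A : Finset V), A.card = n → ∀ c, bitProd A ∅ c ∈ phaseSubmonoid V := by
  induction n with
  | zero =>
    intro A hA c
    rw [Finset.card_eq_zero.1 hA]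
    exact bitProd_empty_mem hV c
  | succ n ih =>
    intro A hA c
    obtain ⟨a, B, haB, rfl, hB⟩ := Finset.card_eq_succ.1 hA
    rcases B.eq_empty_or_nonempty with rfl | ⟨b, hb⟩
    · simpa using bitProd_singleton_mem a c
    · obtain ⟨S, hbS, rfl⟩ : ∃ S, b ∉ S ∧ insert b S = B :=
        ⟨B.erase b, Finset.notMem_erase b B, Finset.insert_erase hb⟩
      have hab : a ≠ b := fun e => haB (e ▸ Finset.mem_insert_self _ _)
      have haS : a ∉ S := fun e => haB (Finset.mem_insert_of_mem e)
      have hcard : (insert a S).card = n := by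
        rw [Finset.card_insert_of_notMem haS, ← hB, Finset.card_insert_of_notMem hbS]
      have key : bitProd (insert a (insert b S)) ∅ c =
          bitProd (insert a S) ∅ (c / 2) + bitProd (insert b S) ∅ (c / 2) +
            fun x => bitProd (insert a S) ∅ (-c / 2) (cnotLabel a b x) := by
        funext x
        have hS : (∀ i ∈ S, cnotLabel a b x i = 1) ↔ ∀ i ∈ S, x i = 1 := by
          refine forall₂_congr fun i hi => ?_
          rw [cnotLabel, Function.update_of_ne (fun e : i = a => haS (e ▸ hi))]
        have h01 : ∀ y : Fin 2, y = 0 ∨ y = 1 := by decide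
        simp only [Pi.add_apply, bitProd, Finset.forall_mem_insert, hS, Finset.notMem_empty,
          false_imp_iff, implies_true, and_true]
        rcases h01 (x a) with ha | ha <;> rcases h01 (x b) with hb | hb <;>
          simp only [ha, hb, cnotLabel, Function.update_self] <;> simp [-Subtype.forall] <;>
          split_ifs <;> ring
      rw [key]
      exact add_mem (add_mem (ih _ hcard _) (ih _ hB _)) (comp_cnotLabel_mem (ih _ hcard _) hab)

/-- A negated bit is 1 - x_b, so the product splits into two with one negation fewer. -/
theorem bitProd_mem (hV : V.Nonempty) (B : Finset V) :
    ∀ (A : Finset V) (c : ℝ), bitProd A B c ∈ phaseSubmonoid V := by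
  induction B using Finset.induction_on with
  | empty => exact fun A c => bitProd_left_mem hV _ A rfl c
  | insert b B hb ih =>
    intro A c
    have key : bitProd A (insert b B) c = bitProd A B c + bitProd (insert b A) B (-c) := by
      funext x
      have h01 : ∀ y : Fin 2, y = 0 ∨ y = 1 := by decide
      simp only [Pi.add_apply, bitProd, Finset.forall_mem_insert]
      rcases h01 (x b) with h | h <;> simp [h]
      split_ifs <;> simp
    rw [key]
    exact add_mem (ih _ _) (ih _ _)

/-- With every bit prescribed, `bitProd` is supported at a single label, and every function is a sum
of such. -/
theorem phaseSubmonoid_eq_top (hV : V.Nonempty) : phaseSubmonoid V = ⊤ := by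
  refine eq_top_iff.2 fun θ _ => ?_
  have key : θ = ∑ y : V → Fin 2, bitProd (univ.filter (y · = 1)) (univ.filter (y · = 0)) (θ y) := by
    funext x
    have h01 : ∀ y : Fin 2, y = 0 ∨ y = 1 := by decide
    have h : ∀ y : V → Fin 2, bitProd (univ.filter (y · = 1)) (univ.filter (y · = 0)) (θ y) x =
        if y = x then θ y else 0 := by
      intro y
      refine if_congr ⟨fun h => ?_, ?_⟩ rfl rfl
      · funext i
        rcases h01 (y i) with hi | hi
        · rw [hi, h.2 i (by simpa using hi)]
        · rw [hi, h.1 i (by simpa using hi)]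
      · rintro rfl
        simp
    simp only [Finset.sum_apply, h, Finset.sum_ite_eq', Finset.mem_univ, if_true]
  rw [key]
  exact sum_mem fun y _ => bitProd_mem hV _ _ _

theorem diagOp_mem (hV : V.Nonempty) {d : (V → Fin 2) → ℂ} (hd : ∀ x, ‖d x‖ = 1) :
    diagOp d ∈ Submonoid.closure (gates V) := by
  have h : phaseOp (fun x => (d x).arg) = diagOp d := by
    rw [phaseOp]
    congr 1
    funext x
    have := Complex.norm_mul_exp_arg_mul_I (d x)
    rw [hd x] at this
    rw [mul_comm]
    simpa using this
  rw [← h, ← mem_phaseSubmonoid, phaseSubmonoid_eq_top hV]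
  trivial

end Diagonal

/-! ### The gates generate all unitary operators -/

section Universality

variable {V : Finset ℕ}

theorem inner_map_of_mem {g : Module.End ℂ (Hil V)} (hg : g ∈ unitary (Module.End ℂ (Hil V)))
    (p q : Hil V) : inner ℂ (g p) (g q) = (inner ℂ p q : ℂ) := by
  rw [← LinearMap.adjoint_inner_left, ← LinearMap.star_eq_adjoint, ← Module.End.mul_apply,
    (Unitary.mem_iff.1 hg).1, Module.End.one_apply]

theorem norm_map_of_mem {g : Module.End ℂ (Hil V)} (hg : g ∈ unitary (Module.End ℂ (Hil V)))
    (p : Hil V) : ‖g p‖ = ‖p‖ := by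
  rw [@norm_eq_sqrt_re_inner ℂ, @norm_eq_sqrt_re_inner ℂ, inner_map_of_mem hg]

/-- Diagonal unitaries adjust the phases of the coordinates at will. -/
theorem exists_map_eq_of_norm_eq (hV : V.Nonempty) {p q : Hil V} (h : ∀ x, ‖p x‖ = ‖q x‖) :
    ∃ g ∈ Submonoid.closure (gates V), g p = q := by
  refine ⟨diagOp fun x => if p x = 0 then 1 else q x / p x, diagOp_mem hV fun x => ?_, ?_⟩
  · split_ifs with hx
    · simp
    · rw [norm_div, h, div_self]
      rwa [← h, norm_ne_zero_iff]
  · ext x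
    rw [diagOp_apply]
    split_ifs with hx
    · have := h x
      rw [hx, norm_zero] at this
      rw [hx, mul_zero, norm_eq_zero.1 this.symm]
    · rw [div_mul_cancel₀ _ hx]

/-- One bit can be cleared in a state, without disturbing the zeros of the other bits. -/
theorem exists_clear_bit (hV : V.Nonempty) (i : V) (q : Hil V) :
    ∃ g ∈ Submonoid.closure (gates V), ∀ x, x i = 1 ∨ (∀ b, q (Function.update x i b) = 0) →
      g q x = 0 := by
  have h01 : ∀ a : Fin 2, a = 0 ∨ a = 1 := by decide
  -- Make the amplitudes real where bit i is 0 and imaginary where it is 1. Then H turns each pair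
  -- (a, ib) into (a ± ib)/√2, two numbers of equal modulus.
  obtain ⟨g₁, hg₁, h₁⟩ := exists_map_eq_of_norm_eq hV (p := q)
    (q := WithLp.toLp 2 fun x => if x i = 0 then (‖q x‖ : ℂ) else Complex.I * ‖q x‖) fun x => by
      dsimp only
      split_ifs <;> simp
  set u : Hil V := localOp (matJ 0) i (g₁ q) with hu
  -- Once the phases are removed, both entries of each pair coincide, and a second H sends the pair
  -- to a multiple of |0⟩.
  obtain ⟨g₂, hg₂, h₂⟩ := exists_map_eq_of_norm_eq hV (p := u)
    (q := WithLp.toLp 2 fun x => (‖u x‖ : ℂ)) fun x => by simp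
  have hH := localOp_matJ_zero_mem i
  refine ⟨localOp (matJ 0) i * g₂ * localOp (matJ 0) i * g₁,
    mul_mem (mul_mem (mul_mem hH hg₂) hH) hg₁, fun x hx => ?_⟩
  have e : (localOp (matJ 0) i * g₂ * localOp (matJ 0) i * g₁ : Module.End ℂ (Hil V)) q x =
      ∑ b, matJ 0 (x i) b * (‖u (Function.update x i b)‖ : ℂ) := by
    simp only [Module.End.mul_apply]
    rw [← hu, h₂, localOp_apply]
  have hval : ∀ b, u (Function.update x i b) = ((1 / Real.sqrt 2 : ℝ) : ℂ) *
      ((‖q (Function.update x i 0)‖ : ℂ) +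
        (if b = 0 then 1 else -1) * (Complex.I * ‖q (Function.update x i 1)‖)) := by
    intro b
    rw [hu, localOp_apply, h₁]
    simp only [Fin.sum_univ_two, Function.update_self, Function.update_idem]
    rcases h01 b with rfl | rfl <;> simp [matJ] <;> ring
  have hconj : ∀ a b : ℝ, ‖(a : ℂ) + Complex.I * b‖ = ‖(a : ℂ) + -(Complex.I * b)‖ := by
    intro a b
    rw [← Complex.norm_conj]
    congr 1
    simp
  have hn : ‖u (Function.update x i 0)‖ = ‖u (Function.update x i 1)‖ := by
    rw [hval, hval, norm_mul, norm_mul]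
    simp only [if_true, one_mul, one_ne_zero, if_false, neg_one_mul, hconj]
  rw [e, Fin.sum_univ_two]
  rcases hx with hx | hx
  · rw [hn, hx]
    simp [matJ]
  · simp [hval, hx]

theorem exists_clear_bits (hV : V.Nonempty) (q : Hil V) (T : Finset V) :
    ∃ g ∈ Submonoid.closure (gates V), ∀ x, (∃ i ∈ T, x i = 1) → g q x = 0 := by
  induction T using Finset.induction_on with
  | empty => exact ⟨1, one_mem _, by simp⟩
  | insert i T hi ih =>
    obtain ⟨g, hg, h⟩ := ih
    obtain ⟨k, hk, h'⟩ := exists_clear_bit hV i (g q)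
    refine ⟨k * g, mul_mem hk hg, fun x hx => h' x ?_⟩
    obtain ⟨j, hj, hxj⟩ := hx
    rcases Finset.mem_insert.1 hj with rfl | hj
    · exact Or.inl hxj
    -- A bit cleared earlier stays clear: where it is 1, the amplitudes for both values of bit i
    -- already vanish.
    · refine Or.inr fun b => h _ ⟨j, hj, ?_⟩
      rw [Function.update_of_ne (fun e : j = i => hi (e ▸ hj)), hxj]

/-- The gates act transitively on the states of a given norm. -/
theorem exists_map_eq_single (hV : V.Nonempty) (q : Hil V) :
    ∃ g ∈ Submonoid.closure (gates V), g q = EuclideanSpace.single 0 (‖q‖ : ℂ) := by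
  obtain ⟨g, hg, h⟩ := exists_clear_bits hV q univ
  have h01 : ∀ a : Fin 2, a ≠ 1 → a = 0 := by decide
  have h0 : g q = EuclideanSpace.single 0 (g q 0) := by
    ext x
    by_cases hx : x = 0
    · simp [hx]
    · obtain ⟨i, hi⟩ := Function.ne_iff.1 hx
      have hi' : x i = 1 := by
        by_contra hne
        exact hi (h01 _ hne)
      rw [h x ⟨i, mem_univ _, hi'⟩]
      simp [hx]
  have hn : ‖g q 0‖ = ‖q‖ := by
    rw [← norm_map_of_mem (closure_gates_le_unitary V hg) q, h0]
    simp
  -- Only the phase of the surviving coordinate is still wrong.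
  obtain ⟨k, hk, h'⟩ := exists_map_eq_of_norm_eq hV (p := g q)
    (q := EuclideanSpace.single 0 (‖q‖ : ℂ)) fun x => by
      rw [h0]
      by_cases hx : x = 0
      · simp [hx, hn]
      · simp [hx]
  exact ⟨k * g, mul_mem hk hg, h'⟩

/-- The unitary with eigenvalue `l` on `v` that fixes the orthogonal complement of `v`, for a unit
vector `v`. -/
def complexReflection (v : Hil V) (l : ℂ) : Module.End ℂ (Hil V) where
  toFun q := q + ((l - 1) * inner ℂ v q) • v
  map_add' p q := by
    rw [inner_add_right, mul_add, add_smul]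
    abel
  map_smul' c q := by
    rw [inner_smul_right, smul_add, smul_smul, RingHom.id_apply, mul_left_comm]

theorem complexReflection_apply (v : Hil V) (l : ℂ) (q : Hil V) :
    complexReflection v l q = q + ((l - 1) * inner ℂ v q) • v := rfl

/-- Transitivity moves `v` to a basis vector, where the reflection becomes diagonal. -/
theorem complexReflection_mem (hV : V.Nonempty) {v : Hil V} (hv : ‖v‖ = 1) {l : ℂ}
    (hl : ‖l‖ = 1) : complexReflection v l ∈ Submonoid.closure (gates V) := by
  obtain ⟨g, hg, h⟩ := exists_map_eq_single hV v
  rw [hv, Complex.ofReal_one] at h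
  have hu := Unitary.mem_iff.1 (closure_gates_le_unitary V hg)
  have hs : ∀ q, star g (g q) = q := fun q => by
    rw [← Module.End.mul_apply, hu.1, Module.End.one_apply]
  have e : complexReflection v l = star g * diagOp (fun x => if x = 0 then l else 1) * g := by
    refine LinearMap.ext fun q => ?_
    have hd : diagOp (fun x => if x = 0 then l else 1) (g q) =
        g q + ((l - 1) * inner ℂ v q) • g v := by
      have hi : (inner ℂ v q : ℂ) = g q 0 := by
        rw [← inner_map_of_mem (closure_gates_le_unitary V hg), h, EuclideanSpace.inner_single_left,
          map_one, one_mul]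
      rw [hi, h]
      ext x
      rw [diagOp_apply]
      by_cases hx : x = 0
      · simp [hx]
        ring
      · simp [hx]
    rw [Module.End.mul_apply, Module.End.mul_apply, hd, map_add, map_smul, hs, hs,
      complexReflection_apply]
  rw [e]
  refine mul_mem (mul_mem (star_mem_closure_gates hg) (diagOp_mem hV fun x => ?_)) hg
  split_ifs
  · exact hl
  · exact norm_one

/-- A vector can be moved to any other vector of the same norm by a generated operator that fixes
all vectors orthogonal to their difference. -/
theorem exists_reflection (hV : V.Nonempty) {a b : Hil V} (h : ‖a‖ = ‖b‖) :
    ∃ g ∈ Submonoid.closure (gates V), g a = b ∧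
      ∀ c, (inner ℂ (a - b) c : ℂ) = 0 → g c = c := by
  rcases eq_or_ne a b with rfl | hab
  · exact ⟨1, one_mem _, rfl, fun c _ => rfl⟩
  have hn : ‖a - b‖ ≠ 0 := norm_ne_zero_iff.2 (sub_ne_zero.2 hab)
  have hn' : (‖a - b‖ : ℂ) ≠ 0 := Complex.ofReal_ne_zero.2 hn
  set z : ℂ := inner ℂ (a - b) a with hz
  -- As a and b have equal norm, ‖a - b‖² is twice the real part of z; in particular z cannot
  -- vanish.
  have hsum : (‖a - b‖ : ℂ) ^ 2 = z + star z := by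
    have h1 : (inner ℂ (a - b) (a - b) : ℂ) = (‖a - b‖ : ℂ) ^ 2 := inner_self_eq_norm_sq_to_K _
    have h2 : star z = inner ℂ a (a - b) := inner_conj_symm a (a - b)
    have h3 : (inner ℂ a a : ℂ) = inner ℂ b b := by
      rw [inner_self_eq_norm_sq_to_K, inner_self_eq_norm_sq_to_K, h]
    rw [← h1, h2, hz]
    simp only [inner_sub_left, inner_sub_right]
    linear_combination -h3
  have hz0 : z ≠ 0 := by
    intro e
    rw [e] at hsum
    simp [hn'] at hsum
  -- The eigenvalue l = -z̄/z has modulus 1 and satisfies (l - 1)z = -(z + z̄) = -‖a - b‖², so a is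
  -- sent to a - (a - b) = b.
  refine ⟨complexReflection (((‖a - b‖ : ℂ)⁻¹) • (a - b)) (-star z / z),
    complexReflection_mem hV ?_ ?_, ?_, fun c hc => ?_⟩
  · rw [norm_smul, norm_inv, Complex.norm_real, norm_norm, inv_mul_cancel₀ hn]
  · rw [norm_div, norm_neg, norm_star, div_self (norm_ne_zero_iff.2 hz0)]
  · rw [complexReflection_apply, inner_smul_left, ← hz, smul_smul, map_inv₀, Complex.conj_ofReal]
    have e : (-star z / z - 1) * ((‖a - b‖ : ℂ)⁻¹ * z) * (‖a - b‖ : ℂ)⁻¹ = -1 := by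
      field_simp
      linear_combination hsum
    rw [e]
    simp
  · rw [complexReflection_apply, inner_smul_left, hc]
    simp

/-- Finitely many basis vectors can be returned to their place after a unitary operator. -/
theorem exists_fix_basis (hV : V.Nonempty) {U : Module.End ℂ (Hil V)}
    (hU : U ∈ unitary (Module.End ℂ (Hil V))) (T : Finset (V → Fin 2)) :
    ∃ g ∈ Submonoid.closure (gates V), ∀ x ∈ T,
      g (U (EuclideanSpace.single x 1)) = EuclideanSpace.single x 1 := by
  induction T using Finset.induction_on with
  | empty => exact ⟨1, one_mem _, by simp⟩
  | insert x T hx ih =>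
    obtain ⟨g, hg, h⟩ := ih
    have hgU : g * U ∈ unitary (Module.End ℂ (Hil V)) :=
      mul_mem (closure_gates_le_unitary V hg) hU
    obtain ⟨k, hk, h1, h2⟩ := exists_reflection hV (a := (g * U) (EuclideanSpace.single x 1))
      (b := EuclideanSpace.single x 1) (norm_map_of_mem hgU _)
    refine ⟨k * g, mul_mem hk hg, fun y hy => ?_⟩
    rcases Finset.mem_insert.1 hy with rfl | hy
    · exact h1
    · rw [Module.End.mul_apply, h y hy]
      -- The new reflection spares e_y: `g * U` preserves inner products and already fixes e_y, so
      -- e_y is orthogonal to the difference of `(g * U) e_x` and e_x.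
      refine h2 _ ?_
      have e : (EuclideanSpace.single y 1 : Hil V) = (g * U) (EuclideanSpace.single y 1) :=
        (h y hy).symm
      rw [inner_sub_left]
      nth_rewrite 1 [e]
      rw [inner_map_of_mem hgU, sub_self]

theorem closure_gates_eq_unitary (hV : V.Nonempty) :
    Submonoid.closure (gates V) = unitary (Module.End ℂ (Hil V)) := by
  refine le_antisymm (closure_gates_le_unitary V) fun U hU => ?_
  obtain ⟨g, hg, h⟩ := exists_fix_basis hV hU univ
  have e : g * U = 1 := by
    refine (EuclideanSpace.basisFun (V → Fin 2) ℂ).toBasis.ext fun x => ?_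
    simpa using h x (mem_univ _)
  have e' : U = star g := by
    rw [← one_mul U, ← (Unitary.mem_iff.1 (closure_gates_le_unitary V hg)).1, mul_assoc, e, mul_one]
  rw [e']
  exact star_mem_closure_gates hg

end Universality

/-! ### States as functions of all bits -/

/-- A state as a function of the bits of all qubits. -/
def ext {V : Finset ℕ} (q : Hil V) (x : ℕ → Fin 2) : ℂ := q fun k => x k.1

/-- The function `f` does not depend on the bits in `S`. -/
def Indep (S : Finset ℕ) (f : (ℕ → Fin 2) → ℂ) : Prop :=
  ∀ x y : ℕ → Fin 2, (∀ k ∉ S, x k = y k) → f x = f y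

theorem Indep.mono {S T : Finset ℕ} {f : (ℕ → Fin 2) → ℂ} (h : Indep T f) (hST : S ⊆ T) :
    Indep S f :=
  fun x y hxy => h x y fun k hk => hxy k fun hk' => hk (hST hk')

theorem Indep.update {S : Finset ℕ} {f : (ℕ → Fin 2) → ℂ} (h : Indep S f) {i : ℕ} (hi : i ∈ S)
    (x : ℕ → Fin 2) (b : Fin 2) : f (Function.update x i b) = f x :=
  h _ _ fun k hk => Function.update_of_ne (fun e : k = i => hk (e ▸ hi)) _ _

theorem ext_injective {V : Finset ℕ} : Function.Injective (ext : Hil V → (ℕ → Fin 2) → ℂ) := by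
  intro p q h
  ext x
  have := congrFun h fun n => bit x n
  simpa [ext, bit_coe] using this

theorem indep_ext {V S : Finset ℕ} (h : Disjoint S V) (q : Hil V) : Indep S (ext q) := by
  intro x y hxy
  refine congrArg q (funext fun k => hxy k fun hk => ?_)
  exact Finset.disjoint_left.1 h hk k.2

/-- A 1-qubit operator at the qubit `i`, on functions of all bits. -/
def localExt (A : Matrix (Fin 2) (Fin 2) ℂ) (i : ℕ) : Module.End ℂ ((ℕ → Fin 2) → ℂ) where
  toFun f x := ∑ b : Fin 2, A (x i) b * f (Function.update x i b)
  map_add' f g := by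
    funext x
    simp [mul_add, Finset.sum_add_distrib]
  map_smul' c f := by
    funext x
    simp only [Pi.smul_apply, smul_eq_mul, RingHom.id_apply, Finset.mul_sum]
    exact Finset.sum_congr rfl fun b _ => by ring

/-- Controlled-`Z`, on functions of all bits. -/
def ctrlZExt (i j : ℕ) : Module.End ℂ ((ℕ → Fin 2) → ℂ) where
  toFun f x := (if x i = 1 ∧ x j = 1 then (-1 : ℂ) else 1) * f x
  map_add' f g := by
    funext x
    simp [mul_add]
  map_smul' c f := by
    funext x
    simp only [Pi.smul_apply, smul_eq_mul, RingHom.id_apply]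
    ring

/-- A renaming of the qubits, on functions of all bits. -/
def relabel (e : ℕ → ℕ) : Module.End ℂ ((ℕ → Fin 2) → ℂ) :=
  LinearMap.funLeft ℂ ℂ fun x : ℕ → Fin 2 => x ∘ e

theorem localExt_apply (A : Matrix (Fin 2) (Fin 2) ℂ) (i : ℕ) (f : (ℕ → Fin 2) → ℂ)
    (x : ℕ → Fin 2) : localExt A i f x = ∑ b : Fin 2, A (x i) b * f (Function.update x i b) := rfl

theorem ctrlZExt_apply (i j : ℕ) (f : (ℕ → Fin 2) → ℂ) (x : ℕ → Fin 2) :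
    ctrlZExt i j f x = (if x i = 1 ∧ x j = 1 then (-1 : ℂ) else 1) * f x := rfl

theorem relabel_apply (e : ℕ → ℕ) (f : (ℕ → Fin 2) → ℂ) (x : ℕ → Fin 2) :
    relabel e f x = f (x ∘ e) := rfl

theorem bit_restrict {V : Finset ℕ} {i : ℕ} (hi : i ∈ V) (x : ℕ → Fin 2) :
    bit (fun k : V => x k.1) i = x i := by
  simp [bit, hi]

theorem restrict_update {V W : Finset ℕ} (x : ℕ → Fin 2) (i : ℕ) (b : Fin 2) (h : V ⊆ insert i W) :
    setBit V (fun k : W => x k.1) i b = fun k : V => Function.update x i b k.1 := by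
  funext k
  by_cases hk : k.1 = i
  · simp [setBit, hk]
  · have hW : k.1 ∈ W := by
      simpa [hk] using h k.2
    simp [setBit, hk, bit_restrict hW]

theorem ext_localOp {V : Finset ℕ} {i : ℕ} (hi : i ∈ V) (A : Matrix (Fin 2) (Fin 2) ℂ) (q : Hil V) :
    ext (localOp A i q) = localExt A i (ext q) := by
  funext x
  simp only [ext, localOp, LinearMap.coe_mk, AddHom.coe_mk, localExt_apply, bit_restrict hi,
    restrict_update x i _ (Finset.subset_insert i V)]

theorem ext_ctrlZ {V : Finset ℕ} {i j : ℕ} (hi : i ∈ V) (hj : j ∈ V) (q : Hil V) :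
    ext (ctrlZ i j q) = ctrlZExt i j (ext q) := by
  funext x
  simp only [ext, ctrlZ, LinearMap.coe_mk, AddHom.coe_mk, ctrlZExt_apply, bit_restrict hi,
    bit_restrict hj]

theorem ext_braAt {V W : Finset ℕ} {i : ℕ} (hW : V ⊆ insert i W) (ψ : Fin 2 → ℂ) (q : Hil V)
    (x : ℕ → Fin 2) :
    ext (braAt W ψ i q) x = ∑ b, star (ψ b) * ext q (Function.update x i b) := by
  simp only [ext, braAt, LinearMap.coe_mk, AddHom.coe_mk, restrict_update x i _ hW]

theorem ext_prep {I V : Finset ℕ} (hI : I ⊆ V) (q : Hil I) :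
    ext (prep hI q) = ((1 / Real.sqrt 2 : ℝ) : ℂ) ^ (V \ I).card • ext q := rfl

theorem ext_smul {V : Finset ℕ} (c : ℂ) (q : Hil V) : ext (c • q) = c • ext q := rfl

/-- The state on `I` obtained from a function of all bits by fixing the bits outside `I`. -/
def slice (I : Finset ℕ) (x : ℕ → Fin 2) : ((ℕ → Fin 2) → ℂ) →ₗ[ℂ] Hil I where
  toFun f := WithLp.toLp 2 fun y => f fun n => if h : n ∈ I then y ⟨n, h⟩ else x n
  map_add' _ _ := rfl
  map_smul' _ _ := rfl

theorem slice_apply (I : Finset ℕ) (x : ℕ → Fin 2) (f : (ℕ → Fin 2) → ℂ) (y : I → Fin 2) :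
    slice I x f y = f fun n => if h : n ∈ I then y ⟨n, h⟩ else x n := rfl

/-- The operator `U` on the qubits in `I`, on functions of all bits. -/
def lift {I : Finset ℕ} (U : Module.End ℂ (Hil I)) : Module.End ℂ ((ℕ → Fin 2) → ℂ) where
  toFun f x := ext (U (slice I x f)) x
  map_add' f g := by
    funext x
    rw [map_add, map_add]
    rfl
  map_smul' c f := by
    funext x
    rw [map_smul, map_smul]
    rfl

theorem lift_apply {I : Finset ℕ} (U : Module.End ℂ (Hil I)) (f : (ℕ → Fin 2) → ℂ)
    (x : ℕ → Fin 2) : lift U f x = ext (U (slice I x f)) x := rfl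

theorem lift_one {I : Finset ℕ} : lift (1 : Module.End ℂ (Hil I)) = 1 := by
  ext f x
  simp [lift_apply, ext, slice_apply]

theorem lift_mul {I : Finset ℕ} (U W : Module.End ℂ (Hil I)) : lift (U * W) = lift U * lift W := by
  refine LinearMap.ext fun f => funext fun x => ?_
  rw [Module.End.mul_apply, lift_apply, lift_apply, Module.End.mul_apply]
  congr 2
  ext y
  simp only [slice_apply, lift_apply, ext]
  have e : (fun k : I => if h : (k : ℕ) ∈ I then y ⟨k, h⟩ else x k) = y := by
    funext k
    simp
  -- `slice` reads its base point only outside `I`, so overwriting the bits in `I` has no effect.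
  have e' : slice I (fun n => if h : n ∈ I then y ⟨n, h⟩ else x n) f = slice I x f := by
    ext z
    rw [slice_apply, slice_apply]
    congr 1
    funext n
    split_ifs <;> rfl
  rw [e, e']

theorem lift_ext {I : Finset ℕ} (U : Module.End ℂ (Hil I)) (q : Hil I) :
    lift U (ext q) = ext (U q) := by
  funext x
  rw [lift_apply]
  congr 2
  ext y
  simp [ext, slice_apply]

theorem lift_localOp {I : Finset ℕ} {i : ℕ} (hi : i ∈ I) (A : Matrix (Fin 2) (Fin 2) ℂ) :
    lift (localOp A i : Module.End ℂ (Hil I)) = localExt A i := by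
  refine LinearMap.ext fun f => funext fun x => ?_
  rw [lift_apply, ext_localOp hi, localExt_apply, localExt_apply]
  refine Finset.sum_congr rfl fun b _ => ?_
  congr 1
  simp only [ext, slice_apply]
  congr 1
  funext n
  by_cases hn : n ∈ I
  · simp [hn]
  · have : n ≠ i := fun e => hn (e ▸ hi)
    simp [hn, this]

theorem lift_ctrlZ {I : Finset ℕ} {i j : ℕ} (hi : i ∈ I) (hj : j ∈ I) :
    lift (ctrlZ i j : Module.End ℂ (Hil I)) = ctrlZExt i j := by
  refine LinearMap.ext fun f => funext fun x => ?_
  rw [lift_apply, ext_ctrlZ hi hj, ctrlZExt_apply, ctrlZExt_apply]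
  congr 1
  simp only [ext, slice_apply]
  congr 1
  funext n
  split_ifs <;> rfl

/-- The operator `G` only acts on the qubits in `B`. -/
def LocalTo (B : Finset ℕ) (G : Module.End ℂ ((ℕ → Fin 2) → ℂ)) : Prop :=
  ∀ S, Disjoint S B → ∀ f, Indep S f → Indep S (G f)

theorem LocalTo.mono {B C : Finset ℕ} {G : Module.End ℂ ((ℕ → Fin 2) → ℂ)} (h : LocalTo B G)
    (hBC : B ⊆ C) : LocalTo C G :=
  fun S hS => h S (hS.mono_right hBC)

theorem LocalTo.mul {B : Finset ℕ} {G H : Module.End ℂ ((ℕ → Fin 2) → ℂ)} (hG : LocalTo B G)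
    (hH : LocalTo B H) : LocalTo B (G * H) :=
  fun S hS f hf => hG S hS _ (hH S hS f hf)

theorem localTo_localExt (A : Matrix (Fin 2) (Fin 2) ℂ) (i : ℕ) : LocalTo {i} (localExt A i) := by
  intro S hS f hf x y hxy
  have hi : i ∉ S := fun h => by simpa using Finset.disjoint_left.1 hS h
  rw [localExt_apply, localExt_apply, hxy i hi]
  refine Finset.sum_congr rfl fun b _ => ?_
  rw [hf _ (Function.update y i b) fun k hk => ?_]
  by_cases h : k = i
  · simp [h]
  · simp [h, hxy k hk]

theorem localTo_ctrlZExt (i j : ℕ) : LocalTo {i, j} (ctrlZExt i j) := by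
  intro S hS f hf x y hxy
  have hi : i ∉ S := fun h => by simpa using Finset.disjoint_left.1 hS h
  have hj : j ∉ S := fun h => by simpa using Finset.disjoint_left.1 hS h
  rw [ctrlZExt_apply, ctrlZExt_apply, hxy i hi, hxy j hj, hf x y hxy]

theorem localTo_relabel {B : Finset ℕ} {e : ℕ → ℕ} (h : ∀ n, e n ∈ B ∨ e n = n) :
    LocalTo B (relabel e) := by
  intro S hS f hf x y hxy
  refine hf _ _ fun k hk => hxy _ fun hk' => ?_
  rcases h k with h | h
  · exact Finset.disjoint_left.1 hS hk' h
  · exact hk (h ▸ hk')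

theorem localTo_lift {I : Finset ℕ} (U : Module.End ℂ (Hil I)) : LocalTo I (lift U) := by
  intro S hS f hf x y hxy
  rw [lift_apply, lift_apply]
  have e : slice I x f = slice I y f := by
    ext z
    refine hf _ _ fun k hk => ?_
    split_ifs
    · rfl
    · exact hxy k hk
  rw [e]
  exact indep_ext hS _ _ _ hxy

/-! ### Patterns that implement an operator in any context -/

/-- Run on a state that is `|+⟩` at the non-inputs, with any other qubits around, the pattern
applies `G` exactly, whatever the outcomes of the measurements. -/
def Pattern.Implements {I O : Finset ℕ} (P : Pattern I O)
    (G : Module.End ℂ ((ℕ → Fin 2) → ℂ)) : Prop :=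
  LocalTo P.V G ∧ ∀ σ : CompState, P.V ⊆ σ.V → Indep (P.V \ I) (ext σ.q) →
    (∃ τ, Run P.cmds σ τ) ∧
      ∀ τ, Run P.cmds σ τ → τ.V = σ.V \ P.V ∪ O ∧ ext τ.q = G (ext σ.q)

theorem run_append {L₁ L₂ : List Command} {σ τ : CompState} :
    Run (L₁ ++ L₂) σ τ ↔ ∃ ρ, Run L₁ σ ρ ∧ Run L₂ ρ τ := by
  induction L₁ generalizing σ with
  | nil => simp [Run]
  | cons A L ih =>
    simp only [List.cons_append, Run, ih]
    constructor
    · rintro ⟨ρ, h, π, h', h''⟩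
      exact ⟨π, ⟨ρ, h, h'⟩, h''⟩
    · rintro ⟨π, ⟨ρ, h, h'⟩, h''⟩
      exact ⟨ρ, h, π, h', h''⟩

/-- Only states with |+⟩ at the non-inputs matter. This permits replacing a composite operator by a
simpler one that differs from it only through auxiliary bits. -/
theorem Pattern.Implements.congr {I O : Finset ℕ} {P : Pattern I O}
    {G H : Module.End ℂ ((ℕ → Fin 2) → ℂ)} (h : P.Implements G) (hH : LocalTo P.V H)
    (hGH : ∀ f, Indep (P.V \ I) f → G f = H f) : P.Implements H :=
  ⟨hH, fun σ hσ hi => ⟨(h.2 σ hσ hi).1, fun τ hτ => by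
    rw [← hGH _ hi]
    exact (h.2 σ hσ hi).2 τ hτ⟩⟩

/-- The non-inputs of `Q` lie outside `P.V`, so `P` finds them in |+⟩ and, its operator being local,
leaves them so. -/
theorem Pattern.Implements.comp {I K O : Finset ℕ} {Q : Pattern K O} {P : Pattern I K}
    {G H : Module.End ℂ ((ℕ → Fin 2) → ℂ)} (hQ : Q.Implements H) (hP : P.Implements G)
    (h : P.V ∩ Q.V = K) : (Q.comp P h).Implements (H * G) := by
  have hPV : P.V ⊆ (Q.comp P h).V := Finset.subset_union_left
  have hQV : Q.V ⊆ (Q.comp P h).V := Finset.subset_union_right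
  refine ⟨(hQ.1.mono hQV).mul (hP.1.mono hPV), fun σ hσ hi => ?_⟩
  obtain ⟨⟨ρ, hρ⟩, h1⟩ := hP.2 σ (hPV.trans hσ)
    (hi.mono (Finset.sdiff_subset_sdiff hPV subset_rfl))
  have hK : ∀ n, n ∈ K ↔ n ∈ P.V ∧ n ∈ Q.V := fun n => by
    simpa only [Finset.mem_inter] using iff_of_eq (congrArg (n ∈ ·) h.symm)
  have h2 : ∀ ρ, Run P.cmds σ ρ → Q.V ⊆ ρ.V ∧ Indep (Q.V \ K) (ext ρ.q) := by
    intro ρ hρ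
    obtain ⟨hV, hq⟩ := h1 ρ hρ
    constructor
    · intro n hn
      rw [hV]
      have := hσ (hQV hn)
      have := hK n
      simp only [Finset.mem_union, Finset.mem_sdiff]
      tauto
    · rw [hq]
      refine hP.1 _ (Finset.disjoint_left.2 fun n hn hn' => ?_) _ (hi.mono fun n hn => ?_)
      · rw [Finset.mem_sdiff, hK] at hn
        tauto
      · rw [Finset.mem_sdiff, hK] at hn
        rw [Finset.mem_sdiff]
        exact ⟨hQV hn.1, fun hI => hn.2 ⟨P.inputs_subset hI, hn.1⟩⟩
  constructor
  · obtain ⟨τ, hτ⟩ := (hQ.2 ρ (h2 ρ hρ).1 (h2 ρ hρ).2).1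
    exact ⟨τ, run_append.2 ⟨ρ, hρ, hτ⟩⟩
  · intro τ hτ
    obtain ⟨π, hπ, hτ⟩ := run_append.1 hτ
    obtain ⟨hV, hq⟩ := (hQ.2 π (h2 π hπ).1 (h2 π hπ).2).2 τ hτ
    refine ⟨?_, by rw [hq, (h1 π hπ).2, Module.End.mul_apply]⟩
    rw [hV, (h1 π hπ).1]
    ext n
    have := hK n
    simp only [Pattern.comp, Finset.mem_union, Finset.mem_sdiff]
    tauto

theorem Pattern.Implements.tensor {I₁ O₁ I₂ O₂ : Finset ℕ} {Q : Pattern I₂ O₂} {P : Pattern I₁ O₁}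
    {G H : Module.End ℂ ((ℕ → Fin 2) → ℂ)} (hQ : Q.Implements H) (hP : P.Implements G)
    (h : P.V ∩ Q.V = ∅) : (Q.tensor P h).Implements (H * G) := by
  have hPV : P.V ⊆ (Q.tensor P h).V := Finset.subset_union_left
  have hQV : Q.V ⊆ (Q.tensor P h).V := Finset.subset_union_right
  have hd : ∀ n, n ∈ P.V → n ∉ Q.V := Finset.disjoint_left.1 (Finset.disjoint_iff_inter_eq_empty.2 h)
  refine ⟨(hQ.1.mono hQV).mul (hP.1.mono hPV), fun σ hσ hi => ?_⟩
  obtain ⟨⟨ρ, hρ⟩, h1⟩ := hP.2 σ (hPV.trans hσ) (hi.mono fun n hn => by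
    rw [Finset.mem_sdiff] at hn
    rw [Finset.mem_sdiff, Finset.mem_union]
    have := hd n hn.1
    have := @Q.inputs_subset n
    exact ⟨hPV hn.1, by tauto⟩)
  have h2 : ∀ ρ, Run P.cmds σ ρ → Q.V ⊆ ρ.V ∧ Indep (Q.V \ I₂) (ext ρ.q) := by
    intro ρ hρ
    obtain ⟨hV, hq⟩ := h1 ρ hρ
    constructor
    · intro n hn
      rw [hV]
      have := hσ (hQV hn)
      have := hd n
      simp only [Finset.mem_union, Finset.mem_sdiff]
      tauto
    · rw [hq]
      refine hP.1 _ (Finset.disjoint_left.2 fun n hn hn' => ?_) _ (hi.mono fun n hn => ?_)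
      · rw [Finset.mem_sdiff] at hn
        exact hd n hn' hn.1
      · rw [Finset.mem_sdiff] at hn
        rw [Finset.mem_sdiff, Finset.mem_union]
        have := hd n
        have := @P.inputs_subset n
        exact ⟨hQV hn.1, by tauto⟩
  constructor
  · obtain ⟨τ, hτ⟩ := (hQ.2 ρ (h2 ρ hρ).1 (h2 ρ hρ).2).1
    exact ⟨τ, run_append.2 ⟨ρ, hρ, hτ⟩⟩
  · intro τ hτ
    obtain ⟨π, hπ, hτ⟩ := run_append.1 hτ
    obtain ⟨hV, hq⟩ := (hQ.2 π (h2 π hπ).1 (h2 π hπ).2).2 τ hτ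
    refine ⟨?_, by rw [hq, (h1 π hπ).2, Module.End.mul_apply]⟩
    rw [hV, (h1 π hπ).1]
    ext n
    have := hd n
    have := @P.outputs_subset n
    simp only [Pattern.tensor, Finset.mem_union, Finset.mem_sdiff]
    tauto

/-- A pattern that implements the extension of an isometry realises it. -/
theorem Pattern.Implements.realises {I O : Finset ℕ} {P : Pattern I O}
    {G : Module.End ℂ ((ℕ → Fin 2) → ℂ)} (h : P.Implements G) {U : Hil I →ₗ[ℂ] Hil O}
    (hG : ∀ q, G (ext q) = ext (U q)) (hU : ∀ q, ‖U q‖ = ‖q‖) : P.Realises U := by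
  -- This is the normalisation of the prepared |+⟩ states; every branch ends in exactly c • U q,
  -- whatever the outcomes.
  set c : ℂ := ((1 / Real.sqrt 2 : ℝ) : ℂ) ^ (P.V \ I).card with hc
  have hc0 : c ≠ 0 := pow_ne_zero _ (Complex.ofReal_ne_zero.2 (by positivity))
  have hind : ∀ q : Hil I, Indep (P.V \ I) (ext (prep P.inputs_subset q)) := fun q x y hxy => by
    rw [ext_prep, Pi.smul_apply, Pi.smul_apply, indep_ext Finset.sdiff_disjoint q x y hxy]
  have hGc : ∀ q, G (ext (prep P.inputs_subset q)) = ext (c • U q) := fun q => by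
    rw [ext_prep, map_smul, hG, ext_smul]
  have hbranch : ∀ q q', P.Branch q q' → q' = c • U q := by
    rintro q q' ⟨-, Γ, hrun⟩
    have := ((h.2 ⟨P.V, prep P.inputs_subset q, fun _ => none⟩ subset_rfl (hind q)).2 _ hrun).2
    rw [hGc] at this
    exact ext_injective this
  refine ⟨fun q q' q'' h' h'' => ⟨1, ?_⟩, fun q hq => ⟨?_, fun q' h' => ?_⟩⟩
  · rw [one_smul, hbranch q q' h', hbranch q q'' h'']
  · obtain ⟨⟨⟨W, q', Γ⟩, hrun⟩, hall⟩ :=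
      h.2 ⟨P.V, prep P.inputs_subset q, fun _ => none⟩ subset_rfl (hind q)
    obtain ⟨hV, hq'⟩ := hall _ hrun
    have hW : W = O := by simpa using hV
    subst hW
    rw [hGc] at hq'
    refine ⟨q', ?_, Γ, hrun⟩
    rw [show q' = _ from ext_injective hq']
    refine smul_ne_zero hc0 fun e => hq ?_
    rw [← norm_eq_zero, ← hU, e, norm_zero]
  · have hn : ‖q‖ ≠ 0 := norm_ne_zero_iff.2 hq
    have hcn : ‖c‖ ≠ 0 := norm_ne_zero_iff.2 hc0
    refine ⟨(‖c‖ : ℂ) / c, by simp [hcn], ?_⟩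
    rw [hbranch q q' h', norm_smul, hU, smul_smul, smul_smul]
    have hn' : (‖q‖ : ℂ) ≠ 0 := Complex.ofReal_ne_zero.2 hn
    have hcn' : (‖c‖ : ℂ) ≠ 0 := Complex.ofReal_ne_zero.2 hcn
    have e : (‖c‖ : ℂ) / c * (((‖q‖ / (‖c‖ * ‖q‖) : ℝ) : ℂ) * c) = 1 := by
      push_cast
      field_simp
    rw [← mul_assoc] at e
    rw [e, one_smul]

/-! ### The generating patterns -/

theorem mem_measured_append {L₁ L₂ : List Command} {i : ℕ} :
    i ∈ measured (L₁ ++ L₂) ↔ i ∈ measured L₁ ∨ i ∈ measured L₂ := by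
  simp only [measured, Set.mem_ofPred_eq, List.mem_append, or_and_right, exists_or]

theorem Command.measures_subset_qubits (A : Command) : A.measures ⊆ A.qubits := by
  cases A <;> simp [Command.measures, Command.qubits]

theorem Pattern.mem_of_mem_measured {I O : Finset ℕ} (P : Pattern I O) {i : ℕ}
    (h : i ∈ measured P.cmds) : i ∈ P.V := by
  obtain ⟨A, hA, hi⟩ := h
  exact (P.isOn A hA).1 (A.measures_subset_qubits hi)

theorem patternJ_definite (α : ℝ) (i j : ℕ) (h : i ≠ j) : (patternJ α i j h).Definite := by
  refine ⟨fun L₁ A L₂ hL k hk => ?_, fun L₁ A L₂ hL k hk => ?_, fun k hk => ?_⟩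
  · rcases L₁ with _ | ⟨a, _ | ⟨b, _ | ⟨c, L⟩⟩⟩ <;> simp [patternJ] at hL
    · obtain ⟨rfl, -⟩ := hL
      simp [Command.dependsOn] at hk
    · obtain ⟨-, rfl, -⟩ := hL
      simp [Command.dependsOn] at hk
    · obtain ⟨rfl, rfl, rfl, -⟩ := hL
      simpa [measured, Command.measures, Command.dependsOn] using hk
  · rcases L₁ with _ | ⟨a, _ | ⟨b, _ | ⟨c, L⟩⟩⟩ <;> simp [patternJ] at hL
    · simp [measured]
    · obtain ⟨rfl, rfl, -⟩ := hL
      simp [measured, Command.measures]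
    · obtain ⟨rfl, rfl, rfl, -⟩ := hL
      have : k = j := by simpa [Command.qubits] using hk
      simpa [measured, Command.measures, this] using h.symm
  · have : k = i ∨ k = j := by simpa [patternJ] using hk
    rcases this with rfl | rfl
    · simpa [measured, Command.measures, patternJ] using h
    · simpa [measured, Command.measures, patternJ] using h.symm

theorem patternCZ_definite (i j : ℕ) (h : i ≠ j) : (patternCZ i j h).Definite := by
  refine ⟨fun L₁ A L₂ hL k hk => ?_, fun L₁ A L₂ hL k hk => ?_, fun k hk => ?_⟩
  · rcases L₁ with _ | ⟨a, L⟩ <;> simp [patternCZ] at hL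
    obtain ⟨rfl, -⟩ := hL
    simp [Command.dependsOn] at hk
  · rcases L₁ with _ | ⟨a, L⟩ <;> simp [patternCZ] at hL
    simp [measured]
  · have : k = i ∨ k = j := by simpa [patternCZ] using hk
    rcases this with rfl | rfl <;> simp [measured, Command.measures, patternCZ]

theorem patternCZ_implements (i j : ℕ) (h : i ≠ j) :
    (patternCZ i j h).Implements (ctrlZExt i j) := by
  refine ⟨localTo_ctrlZExt i j, fun ⟨V, q, Γ⟩ hV hi => ?_⟩
  have hiV : i ∈ V := hV (by simp [patternCZ])
  have hjV : j ∈ V := hV (by simp [patternCZ])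
  refine ⟨⟨_, _, .entangle hiV hjV h, rfl⟩, ?_⟩
  rintro τ ⟨ρ, hρ, rfl⟩
  cases hρ
  refine ⟨?_, ext_ctrlZ hiV hjV q⟩
  ext k
  have : k = i ∨ k = j → k ∈ V := by
    rintro (rfl | rfl) <;> assumption
  simp only [patternCZ, Finset.mem_union, Finset.mem_sdiff, Finset.mem_insert, Finset.mem_singleton]
  tauto

/-- The operator acts at qubit i and the result is then read at qubit j. -/
theorem relabel_update_localExt_apply (A : Matrix (Fin 2) (Fin 2) ℂ) (i j : ℕ)
    (f : (ℕ → Fin 2) → ℂ) (x : ℕ → Fin 2) :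
    (relabel (Function.update id i j) * localExt A i) f x =
      ∑ b, A (x j) b * f (Function.update x i b) := by
  have : ∀ b, Function.update (x ∘ Function.update id i j) i b = Function.update x i b := by
    intro b
    funext k
    by_cases hk : k = i
    · simp [hk]
    · simp [hk]
  simp [Module.End.mul_apply, relabel_apply, localExt_apply, this]

theorem localTo_relabel_update (i j : ℕ) : LocalTo {i, j} (relabel (Function.update id i j)) := by
  refine localTo_relabel fun n => ?_
  by_cases hn : n = i
  · simp [hn]
  · simp [hn]

/-- Controlled-Z contributes (-1)^{b x_j}, and the bra at angle -α contributes e^{iα}(-1)^r at b =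
1, since conjugation reverses the angle. For r = 0 this is row x_j of J(α); for r = 1 the two rows
are exchanged, and the correction X_j exchanges them back. -/
theorem patternJ_implements (α : ℝ) (i j : ℕ) (h : i ≠ j) :
    (patternJ α i j h).Implements (relabel (Function.update id i j) * localExt (matJ α) i) := by
  refine ⟨(localTo_relabel_update i j).mul ((localTo_localExt _ i).mono (by simp)),
    fun ⟨V, q, Γ⟩ hV hi => ?_⟩
  have hiV : i ∈ V := hV (by simp [patternJ])
  have hjV : j ∈ V := hV (by simp [patternJ])
  have hjW : j ∈ V.erase i := Finset.mem_erase.2 ⟨h.symm, hjV⟩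
  have hj : j ∈ (patternJ α i j h).V \ {i} := by simp [patternJ, h.symm]
  have hknown : ∀ r, Known (Function.update Γ i (some r)) {i} := fun r => by simp [Known]
  refine ⟨⟨_, _, .entangle hiV hjV h, _, .measure hiV rfl (by simp [Known]) (by simp [Known]) 0, _,
    .correctX hjW (hknown 0), rfl⟩, ?_⟩
  rintro τ ⟨ρ₁, h₁, ρ₂, h₂, ρ₃, h₃, rfl⟩
  cases h₁
  cases h₂ with
  | measure _ hW _ _ r =>
  subst hW
  cases h₃
  constructor
  · ext k
    have : k = j → k ∈ V := fun e => e ▸ hjV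
    have : k = j → k ≠ i := fun e => e ▸ h.symm
    simp only [patternJ, Finset.mem_union, Finset.mem_sdiff, Finset.mem_insert,
      Finset.mem_singleton, Finset.mem_erase]
    tauto
  · funext x
    have hs : signalValue (Function.update Γ i (some r)) {i} = r := by simp [signalValue]
    have ha : depAngle (-α) (signalValue Γ ∅) (signalValue Γ ∅) = -α := by
      simp [depAngle, signalValue]
    have hf : ∀ b c, ext q (Function.update (Function.update x j b) i c) =
        ext q (Function.update x i c) := fun b c => by
      rw [Function.update_comm h.symm]
      exact Indep.update hi hj _ _
    have hconj : (starRingEnd ℂ) (Complex.exp (-(Complex.I * α))) =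
        Complex.exp (Complex.I * α) := by
      rw [← Complex.exp_conj]
      simp
    have hr : ∀ r : ZMod 2, r = 0 ∨ r = 1 := by decide
    have h01 : ∀ a : Fin 2, a = 0 ∨ a = 1 := by decide
    rw [relabel_update_localExt_apply, ext_localOp hjW, localExt_apply]
    simp only [ext_braAt (Finset.insert_erase hiV).ge, ext_ctrlZ hiV hjV, ctrlZExt_apply, hf, hs, ha,
      Fin.sum_univ_two, Function.update_self, Function.update_of_ne h.symm]
    rcases hr r with rfl | rfl <;> rcases h01 (x j) with hx | hx <;> rw [hx] <;>
      simp [measKet, matJ, pauliX, hconj, ZMod.val_one]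

/-! ### Patterns that can be generated -/

/-- Concatenation can only fail when the second list acts on a qubit measured in the first. In a
composite this is excluded because a shared qubit is an output of the first pattern. -/
theorem definite_append {L₁ L₂ : List Command}
    (h₁ : ∀ M A N, L₁ = M ++ A :: N → (∀ i ∈ A.dependsOn, i ∈ measured M) ∧
      ∀ i ∈ A.qubits, i ∉ measured M)
    (h₂ : ∀ M A N, L₂ = M ++ A :: N → (∀ i ∈ A.dependsOn, i ∈ measured M) ∧
      ∀ i ∈ A.qubits, i ∉ measured M)
    (h : ∀ A ∈ L₂, ∀ i ∈ A.qubits, i ∉ measured L₁) {M N : List Command} {A : Command}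
    (hL : L₁ ++ L₂ = M ++ A :: N) :
    (∀ i ∈ A.dependsOn, i ∈ measured M) ∧ ∀ i ∈ A.qubits, i ∉ measured M := by
  have key : ∀ M', M = L₁ ++ M' → L₂ = M' ++ A :: N →
      (∀ i ∈ A.dependsOn, i ∈ measured M) ∧ ∀ i ∈ A.qubits, i ∉ measured M := by
    rintro M' rfl hL₂
    obtain ⟨hd, hq⟩ := h₂ M' A N hL₂
    refine ⟨fun i hi => mem_measured_append.2 (Or.inr (hd i hi)), fun i hi hm => ?_⟩
    rcases mem_measured_append.1 hm with hm | hm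
    · exact h A (by simp [hL₂]) i hi hm
    · exact hq i hi hm
  rcases List.append_eq_append_iff.1 hL with ⟨M', hM, hL₂⟩ | ⟨C, hC, hN⟩
  · exact key M' hM hL₂
  · rcases C with _ | ⟨B, C⟩
    · exact key [] (by simpa using hC.symm) (by simpa using hN.symm)
    · rw [List.cons_append, List.cons.injEq] at hN
      obtain ⟨rfl, -⟩ := hN
      exact h₁ M A C hC

theorem Pattern.Definite.comp {I K O : Finset ℕ} {Q : Pattern K O} {P : Pattern I K}
    (hQ : Q.Definite) (hP : P.Definite) (h : P.V ∩ Q.V = K) : (Q.comp P h).Definite := by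
  have hK : ∀ n, n ∈ K ↔ n ∈ P.V ∧ n ∈ Q.V := fun n => by
    simpa only [Finset.mem_inter] using iff_of_eq (congrArg (n ∈ ·) h.symm)
  have key := @definite_append P.cmds Q.cmds
    (fun M A N hL => ⟨hP.1 M A N hL, hP.2.1 M A N hL⟩)
    (fun M A N hL => ⟨hQ.1 M A N hL, hQ.2.1 M A N hL⟩) fun A hA i hi hm =>
      (hP.2.2 i (P.mem_of_mem_measured hm)).1 hm
        ((hK i).2 ⟨P.mem_of_mem_measured hm, (Q.isOn A hA).1 hi⟩)
  refine ⟨fun M A N hL => (key hL).1, fun M A N hL => (key hL).2, fun i hi => ?_⟩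
  have hi : i ∈ P.V ∪ Q.V := hi
  rw [Finset.mem_union] at hi
  change i ∈ measured (P.cmds ++ Q.cmds) ↔ _
  rw [mem_measured_append]
  have := hK i
  have := hP.2.2 i
  have := hQ.2.2 i
  have := @Pattern.mem_of_mem_measured _ _ P i
  have := @Pattern.mem_of_mem_measured _ _ Q i
  have := @Q.outputs_subset i
  tauto

theorem Pattern.Definite.tensor {I₁ O₁ I₂ O₂ : Finset ℕ} {Q : Pattern I₂ O₂} {P : Pattern I₁ O₁}
    (hQ : Q.Definite) (hP : P.Definite) (h : P.V ∩ Q.V = ∅) : (Q.tensor P h).Definite := by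
  have hd : ∀ n, n ∈ P.V → n ∉ Q.V := Finset.disjoint_left.1 (Finset.disjoint_iff_inter_eq_empty.2 h)
  have key := @definite_append P.cmds Q.cmds
    (fun M A N hL => ⟨hP.1 M A N hL, hP.2.1 M A N hL⟩)
    (fun M A N hL => ⟨hQ.1 M A N hL, hQ.2.1 M A N hL⟩) fun A hA i hi hm =>
      hd i (P.mem_of_mem_measured hm) ((Q.isOn A hA).1 hi)
  refine ⟨fun M A N hL => (key hL).1, fun M A N hL => (key hL).2, fun i hi => ?_⟩
  have hi : i ∈ P.V ∪ Q.V := hi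
  rw [Finset.mem_union] at hi
  change i ∈ measured (P.cmds ++ Q.cmds) ↔ _
  rw [mem_measured_append, Finset.mem_union]
  have := hd i
  have := hP.2.2 i
  have := hQ.2.2 i
  have := @Pattern.mem_of_mem_measured _ _ P i
  have := @Pattern.mem_of_mem_measured _ _ Q i
  have := @Q.outputs_subset i
  have := @P.outputs_subset i
  tauto

/-- For every finite set `A` there is a generated definite pattern that implements `G` and whose
auxiliary qubits avoid `A`. -/
def Implementable (I O : Finset ℕ) (G : Module.End ℂ ((ℕ → Fin 2) → ℂ)) : Prop :=
  ∀ A : Finset ℕ, ∃ P : Pattern I O, Generated P ∧ P.Definite ∧ P.Implements G ∧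
    ∀ n ∈ P.V, n ∈ A → n ∈ I ∪ O

theorem Implementable.tensor {I₁ O₁ I₂ O₂ : Finset ℕ} {G H : Module.End ℂ ((ℕ → Fin 2) → ℂ)}
    (hG : Implementable I₁ O₁ G) (hH : Implementable I₂ O₂ H)
    (h : Disjoint (I₁ ∪ O₁) (I₂ ∪ O₂)) : Implementable (I₁ ∪ I₂) (O₁ ∪ O₂) (H * G) := by
  intro A
  -- `P` is chosen to avoid the inputs and outputs of the second factor, then `Q` to avoid all of
  -- `P`.
  obtain ⟨P, hP, hPd, hPi, hPA⟩ := hG (A ∪ (I₂ ∪ O₂))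
  obtain ⟨Q, hQ, hQd, hQi, hQA⟩ := hH (A ∪ P.V)
  have hPQ : P.V ∩ Q.V = ∅ := by
    refine Finset.eq_empty_of_forall_notMem fun n hn => ?_
    rw [Finset.mem_inter] at hn
    have h2 := hQA n hn.2 (Finset.mem_union_right _ hn.1)
    exact Finset.disjoint_left.1 h (hPA n hn.1 (Finset.mem_union_right _ h2)) h2
  refine ⟨Q.tensor P hPQ, .tensor hPQ hQ hP, hQd.tensor hPd hPQ, hQi.tensor hPi hPQ,
    fun n hn hA => ?_⟩
  have hn : n ∈ P.V ∪ Q.V := hn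
  have h1 := hPA n
  have h2 := hQA n
  simp only [Finset.mem_union] at hn h1 h2 ⊢
  tauto

/-- The intermediate register `K` may depend on the set `A` to be avoided, so it can be taken fresh.
The operators need to agree only on states with |+⟩ at the new qubits. -/
theorem Implementable.comp {I O : Finset ℕ} {F : Module.End ℂ ((ℕ → Fin 2) → ℂ)}
    (hdisj : Disjoint I O) (hF : LocalTo (I ∪ O) F)
    (h : ∀ A : Finset ℕ, ∃ (K : Finset ℕ) (G H : Module.End ℂ ((ℕ → Fin 2) → ℂ)),
      (∀ n ∈ K, n ∈ A → n ∈ I ∪ O) ∧ Implementable I K G ∧ Implementable K O H ∧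
      ∀ f, Indep ((K ∪ O) \ I) f → H (G f) = F f) : Implementable I O F := by
  intro A
  obtain ⟨K, G, H, hK, hG, hH, hGH⟩ := h A
  obtain ⟨P, hP, hPd, hPi, hPA⟩ := hG (A ∪ O)
  obtain ⟨Q, hQ, hQd, hQi, hQA⟩ := hH (A ∪ P.V)
  have hPQ : P.V ∩ Q.V = K := by
    ext n
    have h1 := hPA n
    have h2 := hQA n
    have h3 := @P.outputs_subset n
    have h4 := @Q.inputs_subset n
    have h5 : n ∈ I → n ∉ O := fun hn => Finset.disjoint_left.1 hdisj hn
    simp only [Finset.mem_union, Finset.mem_inter] at h1 h2 ⊢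
    tauto
  refine ⟨Q.comp P hPQ, .comp hPQ hQ hP, hQd.comp hPd hPQ, (hQi.comp hPi hPQ).congr
    (hF.mono (Finset.union_subset (Pattern.inputs_subset _) (Pattern.outputs_subset _)))
    fun f hf => hGH f (hf.mono fun n hn => ?_), fun n hn hA => ?_⟩
  · have h1 := @P.outputs_subset n
    have h2 := @Q.outputs_subset n
    simp only [Finset.mem_sdiff, Finset.mem_union, Pattern.comp] at hn ⊢
    tauto
  · have hn : n ∈ P.V ∪ Q.V := hn
    have h1 := hPA n
    have h2 := hQA n
    have h3 := hK n
    simp only [Finset.mem_union] at hn h1 h2 h3 ⊢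
    tauto

theorem implementable_J {α : ℝ} (hα : α ∈ Set.Icc 0 (2 * Real.pi)) {i j : ℕ} (h : i ≠ j) :
    Implementable {i} {j} (relabel (Function.update id i j) * localExt (matJ α) i) :=
  fun _ => ⟨patternJ α i j h, .ofJ α hα i j h, patternJ_definite α i j h,
    patternJ_implements α i j h, fun _ hn _ => hn⟩

theorem implementable_CZ {i j : ℕ} (h : i ≠ j) : Implementable {i, j} {i, j} (ctrlZExt i j) :=
  fun _ => ⟨patternCZ i j h, .ofCZ i j h, patternCZ_definite i j h, patternCZ_implements i j h,
    fun _ hn _ => Finset.mem_union_left _ hn⟩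

/-- A wire. -/
theorem implementable_wire {i j : ℕ} (h : i ≠ j) :
    Implementable {i} {j} (relabel (Function.update id i j)) := by
  refine Implementable.comp (by simpa using h) (localTo_relabel_update i j) fun A => ?_
  obtain ⟨k, hk⟩ := Infinite.exists_notMem_finset (A ∪ {i, j})
  simp only [Finset.mem_union, Finset.mem_insert, Finset.mem_singleton, not_or] at hk
  obtain ⟨hkA, hki, hkj⟩ := hk
  have h0 : (0 : ℝ) ∈ Set.Icc 0 (2 * Real.pi) := ⟨le_rfl, by positivity⟩
  -- Two copies of 𝔍(0) through the fresh qubit k transport the state unchanged, as J(0)² = 1.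
  refine ⟨{k}, _, _, fun n hn hA => ?_, implementable_J h0 (Ne.symm hki), implementable_J h0 hkj,
    fun f hf => funext fun x => ?_⟩
  · rw [Finset.mem_singleton] at hn
    exact absurd (hn ▸ hA) hkA
  · have hkm : k ∈ ({k} ∪ {j} : Finset ℕ) \ {i} := by simp [hki]
    have hu : ∀ b c, f (Function.update (Function.update x k b) i c) = f (Function.update x i c) :=
      fun b c => by
        rw [Function.update_comm hki]
        exact hf.update hkm _ _
    have hx : x ∘ Function.update id i j = Function.update x i (x j) := by
      funext n
      by_cases hn : n = i
      · simp [hn]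
      · simp [hn]
    have hH := congrFun₂ matJ_zero_mul_self
    simp only [Matrix.mul_apply, Fin.sum_univ_two] at hH
    rw [relabel_update_localExt_apply, relabel_apply, hx]
    simp only [relabel_update_localExt_apply, Fin.sum_univ_two, Function.update_self, hu]
    have h01 : ∀ a : Fin 2, a = 0 ∨ a = 1 := by decide
    have e : matJ 0 (x j) 0 * (matJ 0 0 0 * f (Function.update x i 0) +
        matJ 0 0 1 * f (Function.update x i 1)) + matJ 0 (x j) 1 *
        (matJ 0 1 0 * f (Function.update x i 0) + matJ 0 1 1 * f (Function.update x i 1)) =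
        (1 : Matrix (Fin 2) (Fin 2) ℂ) (x j) 0 * f (Function.update x i 0) +
        (1 : Matrix (Fin 2) (Fin 2) ℂ) (x j) 1 * f (Function.update x i 1) := by
      rw [← hH, ← hH]
      ring
    rw [e]
    rcases h01 (x j) with hj | hj <;> rw [hj] <;> simp

/-- Wires can be put in parallel to an operation. -/
theorem Implementable.extend {e : ℕ → ℕ} {J : Finset ℕ} {F : Module.End ℂ ((ℕ → Fin 2) → ℂ)}
    (h : Implementable J (J.image e) (relabel (J.piecewise e id) * F)) (R : Finset ℕ) :
    Disjoint J R → Set.InjOn e ↑(J ∪ R) → Disjoint (J ∪ R) ((J ∪ R).image e) →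
    Implementable (J ∪ R) ((J ∪ R).image e) (relabel ((J ∪ R).piecewise e id) * F) := by
  induction R using Finset.induction_on with
  | empty =>
    intro _ _ _
    rw [Finset.union_empty]
    exact h
  | insert r R hr ih =>
    intro hJR he hd
    have hsub : J ∪ R ⊆ J ∪ insert r R :=
      Finset.union_subset_union subset_rfl (Finset.subset_insert r R)
    have hr' : r ∈ J ∪ insert r R := Finset.mem_union_right _ (Finset.mem_insert_self r R)
    have hrJ : r ∉ J ∪ R := by
      rw [Finset.mem_union, not_or]
      exact ⟨fun hJ => Finset.disjoint_left.1 hJR hJ (Finset.mem_insert_self r R), hr⟩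
    have hne : ∀ m ∈ J ∪ insert r R, ∀ n ∈ J ∪ insert r R, m ≠ e n := fun m hm n hn hmn =>
      Finset.disjoint_left.1 hd hm (Finset.mem_image.2 ⟨n, hn, hmn.symm⟩)
    have h1 := ih (hJR.mono_right (Finset.subset_insert r R)) (he.mono (by exact_mod_cast hsub))
      (hd.mono hsub (Finset.image_subset_image hsub))
    have h2 := h1.tensor (implementable_wire (hne r hr' r hr')) (by
      refine Finset.disjoint_left.2 fun n hn hn' => ?_
      simp only [Finset.mem_union, Finset.mem_singleton] at hn'
      rcases Finset.mem_union.1 hn with hn | hn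
      · rcases hn' with rfl | rfl
        · exact hrJ hn
        · exact hne _ (hsub hn) r hr' rfl
      · obtain ⟨m, hm, rfl⟩ := Finset.mem_image.1 hn
        rcases hn' with hn' | hn'
        · exact hne r hr' m (hsub hm) hn'.symm
        · exact hrJ (he (hsub hm) hr' hn' ▸ hm))
    have hU : J ∪ R ∪ {r} = J ∪ insert r R := by
      ext n
      simp only [Finset.mem_union, Finset.mem_insert, Finset.mem_singleton]
      tauto
    have hO : (J ∪ R).image e ∪ {e r} = (J ∪ insert r R).image e := by
      rw [← hU, Finset.image_union (J ∪ R) {r}, Finset.image_singleton]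
    have hG : relabel (Function.update id r (e r)) * (relabel ((J ∪ R).piecewise e id) * F) =
        relabel ((J ∪ insert r R).piecewise e id) * F := by
      rw [← mul_assoc]
      congr 1
      refine LinearMap.ext fun f => funext fun x => ?_
      rw [Module.End.mul_apply, relabel_apply, relabel_apply, relabel_apply, Function.comp_assoc]
      congr 2
      funext n
      by_cases hn : n ∈ J ∪ R
      -- The targets avoid the source r of the new wire, so the two renamings do not interfere.
      · have : e n ≠ r := fun e' => hne r hr' n (hsub hn) e'.symm
        rw [Function.comp_apply, Finset.piecewise_eq_of_mem _ _ _ hn,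
          Finset.piecewise_eq_of_mem _ _ _ (hsub hn), Function.update_of_ne this, id]
      · rw [Function.comp_apply, Finset.piecewise_eq_of_notMem _ _ _ hn]
        by_cases hn' : n = r
        · subst hn'
          rw [Finset.piecewise_eq_of_mem _ _ _ hr']
          simp
        · have : n ∉ J ∪ insert r R := by
            rw [← hU, Finset.mem_union, Finset.mem_singleton]
            tauto
          rw [Finset.piecewise_eq_of_notMem _ _ _ this]
          simp [hn']
    rw [hU, hO, hG] at h2
    exact h2

/-! ### Every unitary operator is realised by a generated pattern -/

theorem implementable_wires {e : ℕ → ℕ} {I : Finset ℕ} (hI : I.Nonempty) (he : Set.InjOn e I)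
    (hd : Disjoint I (I.image e)) :
    Implementable I (I.image e) (relabel (I.piecewise e id) * 1) := by
  obtain ⟨i, hi⟩ := hI
  have hU : {i} ∪ I.erase i = I := by
    rw [← Finset.insert_eq, Finset.insert_erase hi]
  have hne : i ≠ e i := fun h =>
    Finset.disjoint_left.1 hd hi (Finset.mem_image.2 ⟨i, hi, h.symm⟩)
  have h : Implementable {i} (Finset.image e {i}) (relabel (({i} : Finset ℕ).piecewise e id) * 1) := by
    rw [Finset.image_singleton, Finset.piecewise_singleton, mul_one]
    exact implementable_wire hne
  have := h.extend (I.erase i) (by simp) (by rwa [hU]) (by rwa [hU])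
  rwa [hU] at this

theorem implementable_localExt {e : ℕ → ℕ} {I : Finset ℕ} (he : Set.InjOn e I)
    (hd : Disjoint I (I.image e)) {α : ℝ} (hα : α ∈ Set.Icc 0 (2 * Real.pi)) {i : ℕ} (hi : i ∈ I) :
    Implementable I (I.image e) (relabel (I.piecewise e id) * localExt (matJ α) i) := by
  have hU : {i} ∪ I.erase i = I := by
    rw [← Finset.insert_eq, Finset.insert_erase hi]
  have hne : i ≠ e i := fun h =>
    Finset.disjoint_left.1 hd hi (Finset.mem_image.2 ⟨i, hi, h.symm⟩)
  have h : Implementable {i} (Finset.image e {i})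
      (relabel (({i} : Finset ℕ).piecewise e id) * localExt (matJ α) i) := by
    rw [Finset.image_singleton, Finset.piecewise_singleton]
    exact implementable_J hα hne
  have := h.extend (I.erase i) (by simp) (by rwa [hU]) (by rwa [hU])
  rwa [hU] at this

theorem localTo_relabel_piecewise (e : ℕ → ℕ) (I : Finset ℕ) :
    LocalTo (I ∪ I.image e) (relabel (I.piecewise e id)) := by
  refine localTo_relabel fun n => ?_
  by_cases hn : n ∈ I
  · rw [Finset.piecewise_eq_of_mem _ _ _ hn]
    exact Or.inl (Finset.mem_union_right _ (Finset.mem_image_of_mem e hn))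
  · rw [Finset.piecewise_eq_of_notMem _ _ _ hn]
    exact Or.inr rfl

theorem implementable_ctrlZExt {e : ℕ → ℕ} {I : Finset ℕ} (he : Set.InjOn e I)
    (hd : Disjoint I (I.image e)) {i j : ℕ} (hi : i ∈ I) (hj : j ∈ I) (hij : i ≠ j) :
    Implementable I (I.image e) (relabel (I.piecewise e id) * ctrlZExt i j) := by
  have hs : {i, j} ⊆ I := by
    simp [Finset.insert_subset_iff, hi, hj]
  have hU : {i, j} ∪ I \ {i, j} = I := Finset.union_sdiff_of_subset hs
  have hd' : Disjoint {i, j} (Finset.image e {i, j}) := hd.mono hs (Finset.image_subset_image hs)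
  have h : Implementable {i, j} (Finset.image e {i, j})
      (relabel (({i, j} : Finset ℕ).piecewise e id) * ctrlZExt i j) := by
    refine Implementable.comp hd' ((localTo_relabel_piecewise e _).mul
      ((localTo_ctrlZExt i j).mono Finset.subset_union_left)) fun A => ⟨{i, j}, _, _,
        fun n hn _ => Finset.mem_union_left _ hn, implementable_CZ hij,
        implementable_wires ⟨i, by simp⟩ (he.mono (by exact_mod_cast hs)) hd', fun f _ => rfl⟩
  have := h.extend (I \ {i, j}) Finset.disjoint_sdiff (by rwa [hU]) (by rwa [hU])
  rwa [hU] at this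

/-- Acting on the renamed qubit and finishing the renaming equals acting first and renaming in one
go. The intermediate renaming need not be injective: collisions with bits in `S` are harmless
because f ignores them. -/
theorem relabel_localExt_relabel (A : Matrix (Fin 2) (Fin 2) ℂ) {e e₁ e₂ : ℕ → ℕ} {S : Finset ℕ}
    {i : ℕ} (hi : i ∉ S) (he : ∀ k ∉ S, e₂ (e₁ k) = e k) (h₁ : ∀ k ∉ S, k ≠ i → e₁ k ≠ e₁ i)
    {f : (ℕ → Fin 2) → ℂ} (hf : Indep S f) :
    relabel e₂ (localExt A (e₁ i) (relabel e₁ f)) = relabel e (localExt A i f) := by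
  funext x
  simp only [relabel_apply, localExt_apply, Function.comp_apply, he i hi]
  refine Finset.sum_congr rfl fun b _ => ?_
  congr 1
  refine hf _ _ fun k hk => ?_
  by_cases hki : k = i
  · simp [hki]
  · rw [Function.comp_apply, Function.update_of_ne (h₁ k hk hki), Function.update_of_ne hki,
      Function.comp_apply, Function.comp_apply, he k hk]

theorem relabel_ctrlZExt_relabel {e e₁ e₂ : ℕ → ℕ} {S : Finset ℕ} {i j : ℕ} (hi : i ∉ S)
    (hj : j ∉ S) (he : ∀ k ∉ S, e₂ (e₁ k) = e k) {f : (ℕ → Fin 2) → ℂ} (hf : Indep S f) :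
    relabel e₂ (ctrlZExt (e₁ i) (e₁ j) (relabel e₁ f)) = relabel e (ctrlZExt i j f) := by
  funext x
  simp only [relabel_apply, ctrlZExt_apply, Function.comp_apply, he i hi, he j hj]
  congr 1
  refine hf _ _ fun k hk => ?_
  rw [Function.comp_apply, Function.comp_apply, Function.comp_apply, he k hk]

/-- Induction on a word of gates: the shorter word goes from `I` to a fresh copy `K`, and the last
gate, with wires in parallel, from `K` to the final register. The claim ranges over all `e` because
the inductive hypothesis is applied to the renaming onto `K`. -/
theorem implementable_lift {I : Finset ℕ} (hI : I.Nonempty) {w : Module.End ℂ (Hil I)}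
    (hw : w ∈ Submonoid.closure (gates I)) :
    ∀ e : ℕ → ℕ, Set.InjOn e I → Disjoint I (I.image e) →
      Implementable I (I.image e) (relabel (I.piecewise e id) * lift w) := by
  induction hw using Submonoid.closure_induction_left with
  | one =>
    intro e he hd
    rw [lift_one]
    exact implementable_wires hI he hd
  | mul_left g hg y hy ih =>
    intro e he hd
    refine Implementable.comp hd ((localTo_relabel_piecewise e I).mul
      ((localTo_lift _).mono Finset.subset_union_left)) fun A => ?_
    set B := A ∪ I ∪ I.image e with hB
    -- A shift beyond every label of `B` makes the copy of `I` disjoint from all qubits in use.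
    set N := B.sup id + 1 with hN
    have hfresh : ∀ n, n + N ∉ B := fun n hn => by
      have : n + N ≤ B.sup id := Finset.le_sup (f := id) hn
      omega
    set K := I.image (· + N) with hK
    have hKB : ∀ n ∈ K, n ∉ B := by
      intro n hn
      obtain ⟨m, -, rfl⟩ := Finset.mem_image.1 hn
      exact hfresh m
    have hIK : Disjoint I K := Finset.disjoint_right.2 fun n hn hnI =>
      hKB n hn (Finset.mem_union_left _ (Finset.mem_union_right _ hnI))
    have hIKO : ∀ n ∈ I, n ∉ K ∪ I.image e := fun n hn h =>
      (Finset.mem_union.1 h).elim (Finset.disjoint_left.1 hIK hn) (Finset.disjoint_left.1 hd hn)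
    -- On `K` this undoes the shift and then applies `e`.
    set e₂ : ℕ → ℕ := fun n => e (n - N) with he₂
    have hO : K.image e₂ = I.image e := by
      rw [hK, Finset.image_image]
      congr 1
      funext n
      simp [he₂]
    have hinj₂ : Set.InjOn e₂ K := by
      intro a ha b hb hab
      obtain ⟨m, hm, rfl⟩ := Finset.mem_image.1 (Finset.mem_coe.1 ha)
      obtain ⟨n, hn, rfl⟩ := Finset.mem_image.1 (Finset.mem_coe.1 hb)
      simp only [he₂, Nat.add_sub_cancel] at hab
      rw [he hm hn hab]
    have hd₂ : Disjoint K (K.image e₂) := by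
      rw [hO]
      exact Finset.disjoint_left.2 fun n hn hn' => hKB n hn (Finset.mem_union_right _ hn')
    have hy₁ := ih (· + N) (fun a _ b _ hab => Nat.add_right_cancel hab) hIK
    have hcomp : ∀ k ∉ K ∪ I.image e,
        K.piecewise e₂ id (I.piecewise (· + N) id k) = I.piecewise e id k := by
      intro k hk
      by_cases hkI : k ∈ I
      · have : k + N ∈ K := Finset.mem_image_of_mem (· + N) hkI
        rw [Finset.piecewise_eq_of_mem _ _ _ hkI, Finset.piecewise_eq_of_mem _ _ _ hkI,
          Finset.piecewise_eq_of_mem _ _ _ this]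
        simp [he₂]
      · rw [Finset.piecewise_eq_of_notMem _ _ _ hkI, Finset.piecewise_eq_of_notMem _ _ _ hkI, id,
          Finset.piecewise_eq_of_notMem _ _ _ (fun h => hk (Finset.mem_union_left _ h)), id]
    have hinj₁ : ∀ i ∈ I, ∀ k ∉ K ∪ I.image e, k ≠ i →
        I.piecewise (· + N) id k ≠ I.piecewise (· + N) id i := by
      intro i hi k hk hki h
      rw [Finset.piecewise_eq_of_mem I _ _ hi] at h
      by_cases hkI : k ∈ I
      · rw [Finset.piecewise_eq_of_mem _ _ _ hkI] at h
        exact hki (Nat.add_right_cancel h)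
      · rw [Finset.piecewise_eq_of_notMem _ _ _ hkI, id] at h
        exact hk (Finset.mem_union_left _ (h ▸ Finset.mem_image_of_mem (· + N) hi))
    have hval : ∀ i ∈ I, I.piecewise (· + N) id i = i + N := fun i hi =>
      Finset.piecewise_eq_of_mem _ _ _ hi
    have hind : ∀ f, Indep ((K ∪ I.image e) \ I) f → Indep (K ∪ I.image e) (lift y f) := by
      intro f hf
      have hdis : Disjoint (K ∪ I.image e) I := Finset.disjoint_right.2 fun n hn => hIKO n hn
      rw [Finset.sdiff_eq_self_of_disjoint hdis] at hf
      exact localTo_lift y _ hdis f hf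
    have havoid : ∀ n ∈ K, n ∈ A → n ∈ I ∪ I.image e := fun n hn hA =>
      absurd (Finset.mem_union_left _ (Finset.mem_union_left _ hA)) (hKB n hn)
    rcases hg with ⟨α, hα, i, hi, rfl⟩ | ⟨i, hi, j, hj, hij, rfl⟩
    · have h₂ := implementable_localExt hinj₂ hd₂ hα (Finset.mem_image_of_mem (· + N) hi)
      rw [hO] at h₂
      refine ⟨K, _, _, havoid, hy₁, h₂, fun f hf => ?_⟩
      have := relabel_localExt_relabel (matJ α) (hIKO i hi) hcomp (hinj₁ i hi) (hind f hf)
      rw [hval i hi] at this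
      rw [lift_mul, lift_localOp hi]
      exact this
    · have h₂ := implementable_ctrlZExt hinj₂ hd₂ (Finset.mem_image_of_mem (· + N) hi)
        (Finset.mem_image_of_mem (· + N) hj) (fun h => hij (Nat.add_right_cancel h))
      rw [hO] at h₂
      refine ⟨K, _, _, havoid, hy₁, h₂, fun f hf => ?_⟩
      have := relabel_ctrlZExt_relabel (hIKO i hi) (hIKO j hj) hcomp (hind f hf)
      rw [hval i hi, hval j hj] at this
      rw [lift_mul, lift_ctrlZ hi hj]
      exact this

/-- A bijection of the labels induces an isometry of the state spaces. -/
def renameIso {I O : Finset ℕ} (e : I ≃ O) : Hil I ≃ₗᵢ[ℂ] Hil O :=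
  LinearIsometryEquiv.piLpCongrLeft 2 ℂ ℂ (Equiv.arrowCongr e (Equiv.refl (Fin 2)))

theorem renameIso_apply {I O : Finset ℕ} (e : I ≃ O) (q : Hil I) (x : O → Fin 2) :
    renameIso e q x = q fun k => x (e k) := rfl

theorem relabel_ext {I O : Finset ℕ} (e : I ≃ O) {e' : ℕ → ℕ} (h : ∀ k : I, e' k = e k)
    (q : Hil I) : relabel e' (ext q) = ext (renameIso e q) := by
  funext x
  simp only [relabel_apply, ext, renameIso_apply, Function.comp_apply, h]

theorem mem_unitary_of_isometry {V : Finset ℕ} (U : Hil V ≃ₗᵢ[ℂ] Hil V) :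
    (U.toLinearEquiv.toLinearMap : Module.End ℂ (Hil V)) ∈ unitary (Module.End ℂ (Hil V)) := by
  have h : star (U.toLinearEquiv.toLinearMap : Module.End ℂ (Hil V)) *
      U.toLinearEquiv.toLinearMap = 1 := by
    refine LinearMap.ext fun q => ext_inner_right ℂ fun p => ?_
    rw [Module.End.mul_apply, LinearMap.star_eq_adjoint, LinearMap.adjoint_inner_left]
    exact U.inner_map_map q p
  exact Unitary.mem_iff.2 ⟨h, mul_eq_one_comm.1 h⟩

theorem exists_pattern_realises {I O : Finset ℕ} (hI : I.Nonempty) (hdisj : Disjoint I O)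
    (U : Hil I ≃ₗᵢ[ℂ] Hil O) :
    ∃ P : Pattern I O, Generated P ∧ P.Definite ∧ P.Realises U.toLinearEquiv.toLinearMap := by
  -- The dimensions 2^|I| and 2^|O| agree.
  have hcard : I.card = O.card := by
    have h := U.toLinearEquiv.finrank_eq
    simpa using h
  let e₀ : I ≃ O := Finset.equivOfCardEq hcard
  let e : ℕ → ℕ := fun n => if h : n ∈ I then e₀ ⟨n, h⟩ else n
  have he : ∀ k : I, e k = e₀ k := fun k => by simp [e]
  have himage : I.image e = O := by
    ext n
    rw [Finset.mem_image]
    constructor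
    · rintro ⟨m, hm, rfl⟩
      rw [he ⟨m, hm⟩]
      exact (e₀ ⟨m, hm⟩).2
    · intro hn
      refine ⟨e₀.symm ⟨n, hn⟩, (e₀.symm ⟨n, hn⟩).2, ?_⟩
      rw [he, Equiv.apply_symm_apply]
  have hinj : Set.InjOn e I := by
    intro a ha b hb hab
    rw [he ⟨a, ha⟩, he ⟨b, hb⟩] at hab
    exact congrArg Subtype.val (e₀.injective (Subtype.ext hab))
  -- Undoing the renaming turns U into a unitary operator on `Hil I`, to which the gate
  -- decomposition applies.
  let W : Hil I ≃ₗᵢ[ℂ] Hil I := U.trans (renameIso e₀).symm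
  have hW := mem_unitary_of_isometry W
  rw [← closure_gates_eq_unitary hI] at hW
  have himp := implementable_lift hI hW e hinj (himage ▸ hdisj)
  rw [himage] at himp
  obtain ⟨P, hP, hPd, hPi, -⟩ := himp ∅
  refine ⟨P, hP, hPd, hPi.realises (fun q => ?_) U.norm_map⟩
  rw [Module.End.mul_apply, lift_ext, relabel_ext e₀ fun k => ?_]
  · congr 1
    exact (renameIso e₀).apply_symm_apply (U q)
  · rw [Finset.piecewise_eq_of_mem _ _ _ k.2, he]

/-! ### The generating patterns realise their operators -/

theorem patternJ_realises (α : ℝ) (i j : ℕ) (h : i ≠ j) :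
    (patternJ α i j h).Realises (wireOp (matJ α) i j) := by
  have hJ : (localOp (matJ α) i : Module.End ℂ (Hil {i})) ∈ unitary (Module.End ℂ (Hil {i})) := by
    have hi : i ∈ ({i} : Finset ℕ) := Finset.mem_singleton_self i
    have h1 : star (localOp (matJ α) i : Module.End ℂ (Hil {i})) * localOp (matJ α) i = 1 := by
      rw [star_localOp _ ⟨i, hi⟩, ← localOp_mul _ _ ⟨i, hi⟩, conjTranspose_matJ_mul_self]
      exact localOp_one ⟨i, hi⟩
    exact Unitary.mem_iff.2 ⟨h1, mul_eq_one_comm.1 h1⟩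
  let e₀ : ({i} : Finset ℕ) ≃ ({j} : Finset ℕ) := Equiv.ofUnique _ _
  -- Splitting the wire operator into a unitary at qubit i and a renaming shows that it is isometric
  -- and matches the implemented operator.
  have hU : ∀ q, wireOp (matJ α) i j q = renameIso e₀ (localOp (matJ α) i q) := by
    intro q
    ext x
    have hj : ∀ y : ({j} : Finset ℕ), y = ⟨j, by simp⟩ := fun y =>
      Subtype.ext (Finset.mem_singleton.1 y.2)
    have hi : i ∈ ({i} : Finset ℕ) := Finset.mem_singleton_self i
    rw [renameIso_apply, localOp_apply _ ⟨i, hi⟩]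
    simp only [wireOp, LinearMap.coe_mk, AddHom.coe_mk]
    refine Finset.sum_congr rfl fun b _ => ?_
    have h1 : bit x j = x (e₀ ⟨i, hi⟩) := by
      rw [hj (e₀ _)]
      simp [bit]
    have h2 : (fun _ : ({i} : Finset ℕ) => b) =
        Function.update (fun k => x (e₀ k)) ⟨i, hi⟩ b := by
      funext k
      have : k = ⟨i, hi⟩ := Subtype.ext (Finset.mem_singleton.1 k.2)
      rw [this, Function.update_self]
    rw [h1, h2]
  refine (patternJ_implements α i j h).realises (fun q => ?_) fun q => ?_
  · rw [hU, Module.End.mul_apply, ← ext_localOp (Finset.mem_singleton_self i), relabel_ext e₀]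
    intro k
    rw [Finset.mem_singleton.1 k.2, Finset.mem_singleton.1 (e₀ k).2, Function.update_self]
  · rw [hU, LinearIsometryEquiv.norm_map, norm_map_of_mem hJ]

theorem patternCZ_realises (i j : ℕ) (h : i ≠ j) :
    (patternCZ i j h).Realises (ctrlZ i j) := by
  have hi : i ∈ ({i, j} : Finset ℕ) := by simp
  have hj : j ∈ ({i, j} : Finset ℕ) := by simp
  exact (patternCZ_implements i j h).realises (fun q => (ext_ctrlZ hi hj q).symm)
    (norm_map_of_mem (gates_subset_unitary _ (Or.inr ⟨i, hi, j, hj, h, rfl⟩)))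

end OneWay

end

theorem mainTheorem4 :
    (∀ (α : ℝ) (i j : ℕ) (h : i ≠ j),
      (OneWay.patternJ α i j h).Definite ∧
      (OneWay.patternJ α i j h).Realises (OneWay.wireOp (OneWay.matJ α) i j)) ∧
    (∀ (i j : ℕ) (h : i ≠ j),
      (OneWay.patternCZ i j h).Definite ∧
      (OneWay.patternCZ i j h).Realises (OneWay.ctrlZ i j)) ∧
    (∀ V : Finset ℕ, V.Nonempty →
      Submonoid.closure (OneWay.gates V) = unitary (Module.End ℂ (OneWay.Hil V))) ∧
    (∀ I O : Finset ℕ, I.Nonempty → Disjoint I O →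
      ∀ U : OneWay.Hil I ≃ₗᵢ[ℂ] OneWay.Hil O,
        ∃ P : OneWay.Pattern I O, OneWay.Generated P ∧ P.Definite ∧
          P.Realises U.toLinearEquiv.toLinearMap) :=
  ⟨fun α i j h => ⟨OneWay.patternJ_definite α i j h, OneWay.patternJ_realises α i j h⟩,
    fun i j h => ⟨OneWay.patternCZ_definite i j h, OneWay.patternCZ_realises i j h⟩,
    fun _ hV => OneWay.closure_gates_eq_unitary hV,
    fun _ _ hI hdisj U => OneWay.exists_pattern_realises hI hdisj U⟩
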